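/- Let $L,T>0$ and $\Omega=(-L,L)$. For a $2L$-periodic function $f$ put $\hat f_k=\frac1{2L}\int_{-L}^{L}f(x)e^{-ik\pi x/L}\,dx$ and $\|f\|_s^2=\sum_{k\in\mathbb Z}(1+k^2)^s|\hat f_k|^2$; for $s\ge 0$ let $H^s_p$ be the space of $2L$-periodic $f\in L^2(\Omega)$ with $\|f\|_s<\infty$, and let $X_s=C^1([0,T];H^s_p)$ with norm $\|w\|_{X_s}^2=\max_{t\in[0,T]}\bigl(\|w(t)\|_s^2+\|w_t(t)\|_s^2\bigr)$. For a positive integer $N$ let $S_N=\mathrm{span}\{e^{ik\pi x/L}: k\in\mathbb Z,\ -N/2\le k\le N/2-1\}$ and $P_Nf=\sum_{-N/2\le k\le N/2-1}\hat f_k e^{ik\pi x/L}$. Let $r\ge 2$ and $s\ge r/2$ be real. Let $\beta:\mathbb R\to\mathbb R$ be integrable, with Fourier transform $\hat\beta(k)=\int_{\mathbb R}\beta(x)e^{-ikx}\,dx$ satisfying, for some constant $C_\beta$, $$0\le\hat\beta(k)\le C_\beta(1+k^2)^{-r/2}\qquad\text{for all }k\in\mathbb R,$$ and let $*$ denote convolution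 over $\mathbb R$ in the variable $x$ (equivalently, convolution over $\Omega$ with the $2L$-periodization of $\beta$). Let $g\in C^2(\mathbb R)$ be real valued, and let $G:\mathbb C\to\mathbb C$ be any extension of $g$ that is $C^2$ as a function of two real variables, for instance $G(z)=g(\mathrm{Re}\,z)$, or $G(z)=z^p$ when $g(x)=x^p$ with an integer $p\ge 1$. Let $\varphi,\psi\in H^s_p$ be real valued, and let the real-valued function $u\in C^1([0,T];H^s_p)$ solve $$u_{tt}=\beta*(u+g(u))_{xx}\ \text{ on }[0,T],\qquad u(\cdot,0)=\varphi,\quad u_t(\cdot,0)=\psi,$$ in the sense that for every smooth $2L$-periodic $\eta$ and every $t\in[0,T]$, $\frac{d}{dt}\int_\Omega u_t\,\eta\,dx=\int_\Omega \bigl(\beta*(u+g(u))\bigr)\,\eta''\,dx$. Then there is a constant $C>0$ such that for every positive integer $N$ and every solution $u^N:[0,T]\to S_N$, twice differentiable in time on $[0,T]$, of the semi-discrete scheme $$u^N_{tt}=\beta*\bigl(u^N_{xx}+P_N(G(u^N))_{xx}\bigr),\qquad u^N(\cdot,0)=P_N\varphi,\quad u^N_t(\cdot,0)=P_N\psi,$$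 one has $u-u^N\in X_{r/2}$ and $$\|u-u^N\|_{X_{r/2}}\le C\,N^{r/2-s}\,\|u\|_{X_s}.$$ The constant $C$ may depend on $T$ and on the other data, in particular on $u$, but not on $N$. -/

import Mathlib

namespace NonlocalWave

/-- The Fourier transform `β̂(k) = ∫_ℝ β(x) e^{-ikx} dx` of a kernel on the line. -/
noncomputable def kernelHat (β : ℝ → ℝ) (k : ℝ) : ℂ :=
  ∫ x : ℝ, (β x : ℂ) * Complex.exp (-(Complex.I * k * x))

/-- The convolution `(β * v)(x) = ∫_ℝ β(y) v(x - y) dy` over the line. For a `2L`-periodic `v` this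
is the integral of `v(y)` over one period against the `2L`-periodization of `β` at `x - y`. -/
noncomputable def conv {E : Type*} [NormedAddCommGroup E] [NormedSpace ℝ E]
    (β : ℝ → ℝ) (v : ℝ → E) : ℝ → E :=
  MeasureTheory.convolution β v (ContinuousLinearMap.lsmul ℝ ℝ) MeasureTheory.volume

/-- The exponential `e^{ikπx/L}`. -/
noncomputable def expMode (L : ℝ) (k : ℤ) (x : ℝ) : ℂ :=
  Complex.exp (Complex.I * k * Real.pi * x / L)

/-- The Fourier coefficient `(1/(2L)) ∫_{-L}^{L} f(x) e^{-ikπx/L} dx`. -/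
noncomputable def pCoeff (L : ℝ) (f : ℝ → ℂ) (k : ℤ) : ℂ :=
  (1 / (2 * L) : ℝ) • ∫ x in (-L)..L, f x * expMode L (-k) x

/-- `pCoeff` is Mathlib's Fourier coefficient on the interval. -/
theorem pCoeff_eq_fourierCoeffOn {L : ℝ} (hL : -L < L) (f : ℝ → ℂ) (k : ℤ) :
    pCoeff L f k = fourierCoeffOn hL f k := by
  have h2 : L - -L = 2 * L := by ring
  have hL0 : (L : ℂ) ≠ 0 := by
    have : L ≠ 0 := by intro h; simp [h] at hL
    exact_mod_cast this
  rw [fourierCoeffOn_eq_integral, pCoeff, ← h2]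
  congr 1
  refine intervalIntegral.integral_congr fun x _ => ?_
  simp only [expMode, fourier_coe_apply, smul_eq_mul]
  rw [mul_comm]
  congr 2
  rw [h2]
  push_cast
  field_simp

/-- The squared norm `‖f‖_s² = ∑_{k ∈ ℤ} (1 + k²)^s |f̂_k|²`. -/
noncomputable def sobSq (L s : ℝ) (f : ℝ → ℂ) : ℝ :=
  ∑' k : ℤ, (1 + (k : ℝ) ^ 2) ^ s * ‖pCoeff L f k‖ ^ 2

/-- The norm `‖f‖_s`. -/
noncomputable def sobNorm (L s : ℝ) (f : ℝ → ℂ) : ℝ := Real.sqrt (sobSq L s f)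

/-- Membership in the periodic Sobolev space `H^s_p(-L, L)`, for `s ≥ 0`: a `2L`-periodic function,
square integrable over `(-L, L)`, for which the series defining `‖f‖_s²` converges. -/
def MemSob (L s : ℝ) (f : ℝ → ℂ) : Prop :=
  Function.Periodic f (2 * L) ∧
  MeasureTheory.MemLp f 2 (MeasureTheory.volume.restrict (Set.Ioo (-L) L)) ∧
  Summable fun k : ℤ => (1 + (k : ℝ) ^ 2) ^ s * ‖pCoeff L f k‖ ^ 2

/-- `w` belongs to `C¹([0,T]; H^s_p)`, and its time derivative is `wt`: both curves take values in
`H^s_p` on `[0,T]`, the difference quotients of `w` converge to `wt` in `‖·‖_s`, and `wt` is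
continuous in `‖·‖_s`. -/
structure IsC1Sob (L s T : ℝ) (w wt : ℝ → ℝ → ℂ) : Prop where
  mem : ∀ t ∈ Set.Icc 0 T, MemSob L s (w t)
  mem_deriv : ∀ t ∈ Set.Icc 0 T, MemSob L s (wt t)
  hasDeriv : ∀ t ∈ Set.Icc 0 T,
    Filter.Tendsto
      (fun τ => sobNorm L s (fun x => (w τ x - w t x) / ((τ - t : ℝ) : ℂ) - wt t x))
      (nhdsWithin t (Set.Icc 0 T \ {t})) (nhds 0)
  continuous_deriv : ∀ t ∈ Set.Icc 0 T,
    Filter.Tendsto (fun τ => sobNorm L s (fun x => wt τ x - wt t x))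
      (nhdsWithin t (Set.Icc 0 T)) (nhds 0)

/-- The norm of `X_s = C¹([0,T]; H^s_p)`:
the maximum over `t ∈ [0,T]` of `(‖w(t)‖_s² + ‖w_t(t)‖_s²)^{1/2}`. -/
noncomputable def xNorm (L s T : ℝ) (w wt : ℝ → ℝ → ℂ) : ℝ :=
  sSup ((fun t => Real.sqrt (sobSq L s (w t) + sobSq L s (wt t))) '' Set.Icc 0 T)

/-- The frequencies `k ∈ ℤ` with `-N/2 ≤ k ≤ N/2 - 1`. -/
noncomputable def freqs (N : ℕ) : Finset ℤ :=
  (Finset.Icc (-(N : ℤ)) (N : ℤ)).filter fun k => -(N : ℤ) ≤ 2 * k ∧ 2 * k ≤ (N : ℤ) - 2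

/-- The space `S_N` spanned by the `e^{ikπx/L}` with `-N/2 ≤ k ≤ N/2 - 1`. -/
noncomputable def trigSpace (L : ℝ) (N : ℕ) : Submodule ℂ (ℝ → ℂ) :=
  Submodule.span ℂ (expMode L '' (freqs N : Set ℤ))

/-- The projection `P_N f(x) = ∑_{-N/2 ≤ k ≤ N/2 - 1} f̂_k e^{ikπx/L}`. -/
noncomputable def proj (L : ℝ) (N : ℕ) (f : ℝ → ℂ) (x : ℝ) : ℂ :=
  ∑ k ∈ freqs N, pCoeff L f k * expMode L k x

/-- `u`, with time derivative `ut`, solves `u_tt = (β * (u + g(u)))_xx` on `[0,T]` in the sense of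
periodic distributions in `x`, with `u(0) = φ` and `u_t(0) = ψ`. -/
structure IsSolution (L T : ℝ) (β g φ ψ : ℝ → ℝ) (u ut : ℝ → ℝ → ℝ) : Prop where
  eqn : ∀ η : ℝ → ℝ, ContDiff ℝ (⊤ : ℕ∞) η → Function.Periodic η (2 * L) →
    ∀ t ∈ Set.Icc 0 T,
      HasDerivWithinAt (fun τ => ∫ x in (-L)..L, ut τ x * η x)
        (∫ x in (-L)..L, conv β (fun y => u t y + g (u t y)) x * iteratedDeriv 2 η x)
        (Set.Icc 0 T) t
  init : u 0 =ᵐ[MeasureTheory.volume] φ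
  init_deriv : ut 0 =ᵐ[MeasureTheory.volume] ψ

/-- `v : [0,T] → S_N`, with time derivative `vt`, solves the semi-discrete scheme
`v_tt = β * (v_xx + (P_N G(v))_xx)`, `v(0) = P_N φ`, `v_t(0) = P_N ψ`. -/
structure IsSemiDiscrete (L T : ℝ) (N : ℕ) (β : ℝ → ℝ) (G : ℂ → ℂ) (φ ψ : ℝ → ℝ)
    (v vt : ℝ → ℝ → ℂ) : Prop where
  mem : ∀ t ∈ Set.Icc 0 T, v t ∈ trigSpace L N
  hasDeriv : ∀ t ∈ Set.Icc 0 T, ∀ x : ℝ,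
    HasDerivWithinAt (fun τ => v τ x) (vt t x) (Set.Icc 0 T) t
  eqn : ∀ t ∈ Set.Icc 0 T, ∀ x : ℝ,
    HasDerivWithinAt (fun τ => vt τ x)
      (conv β (fun y => iteratedDeriv 2 (v t) y +
        iteratedDeriv 2 (proj L N (fun z => G (v t z))) y) x)
      (Set.Icc 0 T) t
  init : ∀ x : ℝ, v 0 x = proj L N (fun y => (φ y : ℂ)) x
  init_deriv : ∀ x : ℝ, vt 0 x = proj L N (fun y => (ψ y : ℂ)) x

end NonlocalWave

/-!
The whole argument takes place on the Fourier side. Convolution with `β` multiplies the mode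
`e^{ikπx/L}` by `β̂(kπ/L)` (`pCoeff_conv`), so the exact solution, tested with `cos (kπx/L)` and
`sin (kπx/L)`, and the semi-discrete solution satisfy the same equations
`ŵ_k'' = -(kπ/L)² β̂(kπ/L) (ŵ_k + (G(w))^_k)` for the retained frequencies `k` (`SolvesModes`), with
the same initial values. Their difference is measured by the finite sum `modeEnergy`, the squared
`H^{r/2}` norm of `P_N u - u^N` and of its time derivative.

The decay of `β̂` with `r ≥ 2` makes the time derivative of this energy depend on the nonlinear
terms only through `G(u) - G(u^N)` in `H¹` (`exists_symbol_bound`), and superposition with a `C²`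
map is Lipschitz on bounded subsets of `H¹` (`exists_superposition_lipschitz`). The `H¹` norm is
compared with the mean squares of the increments `f(x + h) - f(x)`, to which a second order mean
value inequality for `G` applies pointwise; no weak derivatives are needed. Hence
`E' ≤ K (E + ‖u - P_N u‖²)` as long as `E` stays below a threshold on which `K` depends
(`exists_modeEnergy_deriv_le`), and a Grönwall argument bounds `E` by a multiple of
`‖u - P_N u‖²` (`exists_modeEnergy_le`).

Since `G` is only locally Lipschitz, the energies first have to be bounded uniformly in `N` and over
all semi-discrete solutions (`exists_uniform_modeEnergy_bound`). For large `N` the projection error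
is small, uniformly in time by Dini's theorem, also in the borderline case `s = r/2` where it has no
rate; then the Grönwall bound stays below the threshold by itself. For each of the finitely many
other `N` the same comparison, applied to two semi-discrete solutions, shows that there is at most
one. Finally `‖u - P_N u‖_{r/2}² ≤ (N²/16)^{r/2-s} ‖u‖_s²` (`tailSq_le`) gives the rate.
-/

namespace NonlocalWave

open MeasureTheory Set Filter Topology

/-! ### Exponentials and Fourier coefficients -/

theorem expMode_eq_exp_ofReal (L : ℝ) (k : ℤ) (x : ℝ) :
    expMode L k x = Complex.exp (Complex.I * ((k * Real.pi / L * x : ℝ) : ℂ)) := by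
  unfold expMode
  congr 1
  push_cast
  ring

theorem norm_expMode (L : ℝ) (k : ℤ) (x : ℝ) : ‖expMode L k x‖ = 1 := by
  rw [expMode_eq_exp_ofReal, Complex.norm_exp_I_mul_ofReal]

theorem expMode_zero_freq (L x : ℝ) : expMode L 0 x = 1 := by simp [expMode]

theorem expMode_mul_expMode (L : ℝ) (j k : ℤ) (x : ℝ) :
    expMode L j x * expMode L k x = expMode L (j + k) x := by
  unfold expMode
  rw [← Complex.exp_add]
  congr 1
  push_cast
  ring

theorem expMode_add (L : ℝ) (k : ℤ) (x y : ℝ) :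
    expMode L k (x + y) = expMode L k x * expMode L k y := by
  unfold expMode
  rw [← Complex.exp_add]
  congr 1
  push_cast
  ring

theorem expMode_periodic {L : ℝ} (hL : 0 < L) (k : ℤ) :
    Function.Periodic (expMode L k) (2 * L) := by
  intro x
  rw [expMode_add]
  have hL' : (L : ℂ) ≠ 0 := by exact_mod_cast hL.ne'
  have : expMode L k (2 * L) = 1 := by
    unfold expMode
    rw [Complex.exp_eq_one_iff]
    refine ⟨k, ?_⟩
    push_cast
    field_simp
  rw [this, mul_one]

theorem continuous_expMode (L : ℝ) (k : ℤ) : Continuous (expMode L k) := by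
  unfold expMode
  fun_prop

theorem hasDerivAt_expMode (L : ℝ) (k : ℤ) (x : ℝ) :
    HasDerivAt (expMode L k) (Complex.I * k * Real.pi / L * expMode L k x) x := by
  have h : HasDerivAt (fun y : ℝ => Complex.I * k * Real.pi * (y : ℂ) / L)
      (Complex.I * k * Real.pi * 1 / L) x :=
    ((Complex.ofRealCLM.hasDerivAt (x := x)).const_mul _).div_const _
  have := h.cexp
  unfold expMode
  convert this using 1
  ring

theorem integral_expMode {L : ℝ} (hL : 0 < L) (k : ℤ) :
    ∫ x in (-L)..L, expMode L k x = if k = 0 then (2 * L : ℂ) else 0 := by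
  split_ifs with hk
  · subst hk
    simp only [expMode_zero_freq, intervalIntegral.integral_const]
    rw [Complex.real_smul]
    push_cast
    ring
  · have hL' : (L : ℂ) ≠ 0 := by exact_mod_cast hL.ne'
    have hc : Complex.I * k * Real.pi / L ≠ 0 := by
      have : (Real.pi : ℂ) ≠ 0 := by exact_mod_cast Real.pi_ne_zero
      have : (k : ℂ) ≠ 0 := by exact_mod_cast hk
      simp_all
    have h1 : ∀ x ∈ uIcc (-L) L, HasDerivAt
        (fun x => (Complex.I * k * Real.pi / L)⁻¹ * expMode L k x) (expMode L k x) x := by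
      intro x _
      have := (hasDerivAt_expMode L k x).const_mul (Complex.I * k * Real.pi / L)⁻¹
      rwa [inv_mul_cancel_left₀ hc] at this
    rw [intervalIntegral.integral_eq_sub_of_hasDerivAt h1
      ((continuous_expMode L k).intervalIntegrable _ _)]
    have h2 := expMode_periodic hL k (-L)
    rw [show -L + 2 * L = L by ring] at h2
    rw [h2, sub_self]

theorem pCoeff_expMode {L : ℝ} (hL : 0 < L) (j k : ℤ) :
    pCoeff L (expMode L j) k = if j = k then 1 else 0 := by
  have hL' : (L : ℂ) ≠ 0 := by exact_mod_cast hL.ne'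
  unfold pCoeff
  simp only [expMode_mul_expMode, integral_expMode hL, ← sub_eq_add_neg, sub_eq_zero]
  split_ifs
  · rw [Complex.real_smul]
    push_cast
    field_simp
  · simp

theorem intervalIntegrable_mul_expMode {L : ℝ} {f : ℝ → ℂ}
    (hf : IntervalIntegrable f volume (-L) L) (k : ℤ) :
    IntervalIntegrable (fun x => f x * expMode L k x) volume (-L) L :=
  hf.mul_continuousOn (continuous_expMode L k).continuousOn

theorem pCoeff_add {L : ℝ} {f g : ℝ → ℂ} (hf : IntervalIntegrable f volume (-L) L)
    (hg : IntervalIntegrable g volume (-L) L) (k : ℤ) :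
    pCoeff L (fun x => f x + g x) k = pCoeff L f k + pCoeff L g k := by
  unfold pCoeff
  simp only [add_mul]
  rw [intervalIntegral.integral_add (intervalIntegrable_mul_expMode hf _)
    (intervalIntegrable_mul_expMode hg _), smul_add]

theorem pCoeff_sub {L : ℝ} {f g : ℝ → ℂ} (hf : IntervalIntegrable f volume (-L) L)
    (hg : IntervalIntegrable g volume (-L) L) (k : ℤ) :
    pCoeff L (fun x => f x - g x) k = pCoeff L f k - pCoeff L g k := by
  unfold pCoeff
  simp only [sub_mul]
  rw [intervalIntegral.integral_sub (intervalIntegrable_mul_expMode hf _)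
    (intervalIntegrable_mul_expMode hg _), smul_sub]

theorem pCoeff_const_mul (L : ℝ) (c : ℂ) (f : ℝ → ℂ) (k : ℤ) :
    pCoeff L (fun x => c * f x) k = c * pCoeff L f k := by
  unfold pCoeff
  simp only [mul_assoc, intervalIntegral.integral_const_mul, Complex.real_smul]
  ring

theorem pCoeff_div_const (L : ℝ) (c : ℂ) (f : ℝ → ℂ) (k : ℤ) :
    pCoeff L (fun x => f x / c) k = pCoeff L f k / c := by
  simp only [div_eq_inv_mul, pCoeff_const_mul]

theorem pCoeff_congr_ae {L : ℝ} {f g : ℝ → ℂ} (h : f =ᵐ[volume] g) (k : ℤ) :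
    pCoeff L f k = pCoeff L g k := by
  unfold pCoeff
  congr 1
  refine intervalIntegral.integral_congr_ae ?_
  filter_upwards [h] with x hx _
  rw [hx]

theorem pCoeff_trigPoly {L : ℝ} (hL : 0 < L) (S : Finset ℤ) (c : ℤ → ℂ) (k : ℤ) :
    pCoeff L (fun x => ∑ j ∈ S, c j * expMode L j x) k = if k ∈ S then c k else 0 := by
  have h : ∀ S : Finset ℤ, pCoeff L (fun x => ∑ j ∈ S, c j * expMode L j x) k
      = ∑ j ∈ S, c j * pCoeff L (expMode L j) k := by
    intro S
    induction S using Finset.induction_on with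
    | empty => simp [pCoeff]
    | insert a S ha ih =>
      simp only [Finset.sum_insert ha]
      rw [pCoeff_add, ih, pCoeff_const_mul]
      · exact (continuous_const.mul (continuous_expMode L a)).intervalIntegrable _ _
      · exact (continuous_finsetSum _ fun j _ =>
          continuous_const.mul (continuous_expMode L j)).intervalIntegrable _ _
  rw [h]
  simp [pCoeff_expMode hL]

/-- Translation multiplies the `k`-th Fourier coefficient by `e^{ikπh/L}`. -/
theorem pCoeff_translate {L : ℝ} (hL : 0 < L) {f : ℝ → ℂ} (hf : Function.Periodic f (2 * L))
    (h : ℝ) (k : ℤ) :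
    pCoeff L (fun x => f (x + h)) k = expMode L k h * pCoeff L f k := by
  have h1 : ∀ x, f (x + h) * expMode L (-k) x
      = expMode L k h * (f (x + h) * expMode L (-k) (x + h)) := by
    intro x
    rw [expMode_add L (-k) x h]
    have : expMode L k h * expMode L (-k) h = 1 := by
      rw [expMode_mul_expMode, add_neg_cancel, expMode_zero_freq]
    linear_combination (-(f (x + h) * expMode L (-k) x)) * this
  have hper : Function.Periodic (fun x => f x * expMode L (-k) x) (2 * L) :=
    hf.mul (expMode_periodic hL (-k))
  unfold pCoeff
  simp only [h1]
  rw [intervalIntegral.integral_const_mul,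
    intervalIntegral.integral_comp_add_right (fun x => f x * expMode L (-k) x)]
  have := hper.intervalIntegral_add_eq (-L + h) (-L)
  rw [show -L + h + 2 * L = L + h by ring, show -L + 2 * L = L by ring] at this
  rw [this, Complex.real_smul, Complex.real_smul]
  ring

/-- Parseval's identity. -/
theorem hasSum_sq_pCoeff {L : ℝ} (hL : 0 < L) {f : ℝ → ℂ}
    (hf : MemLp f 2 (volume.restrict (Ioo (-L) L))) :
    HasSum (fun k => ‖pCoeff L f k‖ ^ 2) ((2 * L)⁻¹ * ∫ x in (-L)..L, ‖f x‖ ^ 2) := by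
  have hLL : -L < L := by linarith
  have h1 : MemLp f 2 (volume.restrict (Ioc (-L) L)) := by
    rwa [← Measure.restrict_congr_set Ioo_ae_eq_Ioc]
  have := hasSum_sq_fourierCoeffOn hLL h1
  simp only [← pCoeff_eq_fourierCoeffOn hLL, smul_eq_mul] at this
  rwa [show L - -L = 2 * L by ring] at this

theorem _root_.Continuous.memLp_Ioo {L : ℝ} {f : ℝ → ℂ} (hf : Continuous f) :
    MemLp f 2 (volume.restrict (Ioo (-L) L)) := by
  have : IsFiniteMeasure (volume.restrict (Ioo (-L) L)) :=
    ⟨by rw [Measure.restrict_apply_univ]; exact measure_Ioo_lt_top⟩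
  obtain ⟨C, hC⟩ := (isCompact_Icc (a := -L) (b := L)).exists_bound_of_continuousOn
    hf.continuousOn
  refine MemLp.of_bound hf.aestronglyMeasurable C ?_
  filter_upwards [ae_restrict_mem measurableSet_Ioo] with x hx
  exact hC x (Ioo_subset_Icc_self hx)

theorem intervalIntegrable_of_memLp {L : ℝ} (hL : 0 < L) {f : ℝ → ℂ}
    (hf : MemLp f 2 (volume.restrict (Ioo (-L) L))) : IntervalIntegrable f volume (-L) L := by
  have : IsFiniteMeasure (volume.restrict (Ioo (-L) L)) :=
    ⟨by rw [Measure.restrict_apply_univ]; exact measure_Ioo_lt_top⟩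
  rw [intervalIntegrable_iff_integrableOn_Ioo_of_le (by linarith)]
  exact hf.integrable one_le_two

theorem ae_eq_of_ae_eq_Ioc {L : ℝ} (hL : 0 < L) {f g : ℝ → ℂ} (hf : Function.Periodic f (2 * L))
    (hg : Function.Periodic g (2 * L)) (h : f =ᵐ[volume.restrict (Ioc (-L) L)] g) :
    f =ᵐ[volume] g := by
  have h2L : (0 : ℝ) < 2 * L := by linarith
  rw [← Measure.restrict_univ (μ := (volume : Measure ℝ)), ← iUnion_Ioc_add_zsmul h2L (-L)]
  refine (ae_restrict_iUnion_iff _ _).2 fun n => ?_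
  rw [ae_restrict_iff' measurableSet_Ioc]
  rw [Filter.EventuallyEq, ae_restrict_iff' measurableSet_Ioc] at h
  have hq := (measurePreserving_add_right (volume : Measure ℝ)
    (-(n • (2 * L)))).quasiMeasurePreserving.ae h
  filter_upwards [hq] with x hx hmem
  have h1 : x + -(n • (2 * L)) ∈ Ioc (-L) L := by
    have e : (n + 1) • (2 * L) = n • (2 * L) + 2 * L := by rw [add_smul, one_smul]
    rw [e] at hmem
    constructor <;> linarith [hmem.1, hmem.2]
  have h2 := hx h1
  rwa [← sub_eq_add_neg, hf.sub_zsmul_eq, hg.sub_zsmul_eq] at h2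

/-! ### Periodic Sobolev spaces -/

theorem one_le_weight (k : ℤ) : (1 : ℝ) ≤ 1 + (k : ℝ) ^ 2 := by nlinarith [sq_nonneg (k : ℝ)]

theorem weight_pos (k : ℤ) : (0 : ℝ) < 1 + (k : ℝ) ^ 2 := by nlinarith [sq_nonneg (k : ℝ)]

theorem weight_rpow_pos (s : ℝ) (k : ℤ) : (0 : ℝ) < (1 + (k : ℝ) ^ 2) ^ s :=
  Real.rpow_pos_of_pos (weight_pos k) s

theorem weight_rpow_mono {s s' : ℝ} (h : s ≤ s') (k : ℤ) :
    (1 + (k : ℝ) ^ 2) ^ s ≤ (1 + (k : ℝ) ^ 2) ^ s' :=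
  Real.rpow_le_rpow_of_exponent_le (one_le_weight k) h

theorem sobTerm_nonneg (L s : ℝ) (f : ℝ → ℂ) (k : ℤ) :
    0 ≤ (1 + (k : ℝ) ^ 2) ^ s * ‖pCoeff L f k‖ ^ 2 :=
  mul_nonneg (weight_rpow_pos s k).le (sq_nonneg _)

theorem sobSq_nonneg (L s : ℝ) (f : ℝ → ℂ) : 0 ≤ sobSq L s f :=
  tsum_nonneg (sobTerm_nonneg L s f)

theorem sobNorm_sq (L s : ℝ) (f : ℝ → ℂ) : sobNorm L s f ^ 2 = sobSq L s f :=
  Real.sq_sqrt (sobSq_nonneg L s f)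

theorem sobNorm_nonneg (L s : ℝ) (f : ℝ → ℂ) : 0 ≤ sobNorm L s f := Real.sqrt_nonneg _

theorem sobSq_congr_ae {L s : ℝ} {f g : ℝ → ℂ} (h : f =ᵐ[volume] g) :
    sobSq L s f = sobSq L s g := by
  unfold sobSq
  simp only [pCoeff_congr_ae h]

theorem MemSob.intervalIntegrable {L s : ℝ} (hL : 0 < L) {f : ℝ → ℂ} (hf : MemSob L s f) :
    IntervalIntegrable f volume (-L) L :=
  intervalIntegrable_of_memLp hL hf.2.1

theorem MemSob.mono {L s s' : ℝ} (h : s' ≤ s) {f : ℝ → ℂ} (hf : MemSob L s f) :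
    MemSob L s' f := by
  refine ⟨hf.1, hf.2.1, hf.2.2.of_nonneg_of_le (sobTerm_nonneg L s' f) fun k => ?_⟩
  exact mul_le_mul_of_nonneg_right (weight_rpow_mono h k) (sq_nonneg _)

theorem MemSob.sobSq_mono {L s s' : ℝ} (h : s' ≤ s) {f : ℝ → ℂ} (hf : MemSob L s f) :
    sobSq L s' f ≤ sobSq L s f :=
  (hf.mono h).2.2.tsum_le_tsum
    (fun k => mul_le_mul_of_nonneg_right (weight_rpow_mono h k) (sq_nonneg _)) hf.2.2

theorem MemSob.sub {L s : ℝ} (hL : 0 < L) {f g : ℝ → ℂ} (hf : MemSob L s f)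
    (hg : MemSob L s g) : MemSob L s (fun x => f x - g x) := by
  refine ⟨hf.1.sub hg.1, hf.2.1.sub hg.2.1, ?_⟩
  refine ((hf.2.2.mul_left 2).add (hg.2.2.mul_left 2)).of_nonneg_of_le
    (sobTerm_nonneg L s _) fun k => ?_
  rw [pCoeff_sub (hf.intervalIntegrable hL) (hg.intervalIntegrable hL)]
  have h1 : ‖pCoeff L f k - pCoeff L g k‖ ^ 2
      ≤ 2 * ‖pCoeff L f k‖ ^ 2 + 2 * ‖pCoeff L g k‖ ^ 2 := by
    have := norm_sub_le (pCoeff L f k) (pCoeff L g k)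
    nlinarith [sq_nonneg (‖pCoeff L f k‖ - ‖pCoeff L g k‖), norm_nonneg (pCoeff L f k),
      norm_nonneg (pCoeff L g k), norm_nonneg (pCoeff L f k - pCoeff L g k)]
  nlinarith [weight_rpow_pos s k]

theorem MemSob.div_const {L s : ℝ} {f : ℝ → ℂ} (hf : MemSob L s f) (c : ℂ) :
    MemSob L s (fun x => f x / c) := by
  refine ⟨fun x => by simp only [hf.1 x], ?_, ?_⟩
  · simp only [div_eq_inv_mul]
    exact hf.2.1.const_mul _
  · simp only [pCoeff_div_const, norm_div, div_pow]
    refine (hf.2.2.div_const (‖c‖ ^ 2)).congr fun k => ?_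
    ring

theorem summable_inv_weight : Summable fun k : ℤ => (1 + (k : ℝ) ^ 2)⁻¹ := by
  have h : Summable fun k : ℤ => 1 / (k : ℝ) ^ 2 :=
    Real.summable_one_div_int_pow.2 one_lt_two
  have h0 : Summable fun k : ℤ => (if k = 0 then (1 : ℝ) else 0) := (hasSum_ite_eq 0 1).summable
  refine (h.add h0).of_nonneg_of_le (fun k => (inv_pos.2 (weight_pos k)).le) fun k => ?_
  by_cases hk : k = 0
  · simp [hk]
  · have : (0 : ℝ) < (k : ℝ) ^ 2 := by positivity
    simp only [hk, if_false, add_zero, ← one_div]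
    exact one_div_le_one_div_of_le this (by linarith)

/-- The constant `(∑_k (1 + k²)⁻¹)^{1/2}` of the embedding `H¹_p ⊂ C`. -/
noncomputable def embConst : ℝ := Real.sqrt (∑' k : ℤ, (1 + (k : ℝ) ^ 2)⁻¹)

theorem embConst_nonneg : 0 ≤ embConst := Real.sqrt_nonneg _

theorem MemSob.sum_norm_pCoeff_le {L : ℝ} {f : ℝ → ℂ} (hf : MemSob L 1 f) (S : Finset ℤ) :
    ∑ k ∈ S, ‖pCoeff L f k‖ ≤ embConst * sobNorm L 1 f := by
  have h1 : (∑ k ∈ S, ‖pCoeff L f k‖) ^ 2 ≤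
      (∑ k ∈ S, (1 + (k : ℝ) ^ 2)⁻¹) *
        ∑ k ∈ S, (1 + (k : ℝ) ^ 2) ^ (1 : ℝ) * ‖pCoeff L f k‖ ^ 2 := by
    refine Finset.sum_sq_le_sum_mul_sum_of_sq_le_mul _ (fun k _ => (inv_pos.2 (weight_pos k)).le)
      (fun k _ => sobTerm_nonneg L 1 f k) fun k _ => ?_
    rw [Real.rpow_one, inv_mul_cancel_left₀ (weight_pos k).ne']
  have h2 : ∑ k ∈ S, (1 + (k : ℝ) ^ 2)⁻¹ ≤ ∑' k : ℤ, (1 + (k : ℝ) ^ 2)⁻¹ :=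
    summable_inv_weight.sum_le_tsum _ fun k _ => (inv_pos.2 (weight_pos k)).le
  have h3 : ∑ k ∈ S, (1 + (k : ℝ) ^ 2) ^ (1 : ℝ) * ‖pCoeff L f k‖ ^ 2 ≤ sobSq L 1 f :=
    hf.2.2.sum_le_tsum _ fun k _ => sobTerm_nonneg L 1 f k
  have h4 : 0 ≤ ∑' k : ℤ, (1 + (k : ℝ) ^ 2)⁻¹ :=
    tsum_nonneg fun k => (inv_pos.2 (weight_pos k)).le
  unfold embConst sobNorm
  rw [← Real.sqrt_mul h4]
  refine Real.le_sqrt_of_sq_le (h1.trans ?_)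
  exact mul_le_mul h2 h3 (Finset.sum_nonneg fun k _ => sobTerm_nonneg L 1 f k) h4

theorem MemSob.summable_norm_pCoeff {L : ℝ} {f : ℝ → ℂ} (hf : MemSob L 1 f) :
    Summable fun k => ‖pCoeff L f k‖ :=
  summable_of_sum_le (fun _ => norm_nonneg _) hf.sum_norm_pCoeff_le

/-- A function with absolutely summable Fourier coefficients is the sum of its Fourier series. -/
theorem ae_eq_tsum_expMode {L : ℝ} (hL : 0 < L) {f : ℝ → ℂ} (hper : Function.Periodic f (2 * L))
    (hf : MemLp f 2 (volume.restrict (Ioo (-L) L))) (hs : Summable fun k => ‖pCoeff L f k‖) :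
    f =ᵐ[volume] fun x => ∑' k, pCoeff L f k * expMode L k x := by
  set F : ℝ → ℂ := fun x => ∑' k, pCoeff L f k * expMode L k x with hF
  have hterm : ∀ k x, ‖pCoeff L f k * expMode L k x‖ ≤ ‖pCoeff L f k‖ := fun k x => by
    rw [norm_mul, norm_expMode, mul_one]
  have hFc : Continuous F :=
    continuous_tsum (fun k => continuous_const.mul (continuous_expMode L k)) hs hterm
  have hFper : Function.Periodic F (2 * L) := fun x => by
    simp only [hF, expMode_periodic hL _ x]
  -- `F` has the same Fourier coefficients as `f`, hence `f - F` vanishes by Parseval's identity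
  have hcoef : ∀ k, pCoeff L F k = pCoeff L f k := by
    intro k
    have h1 : HasSum (fun j => ∫ x in (-L)..L, pCoeff L f j * expMode L j x * expMode L (-k) x)
        (∫ x in (-L)..L, F x * expMode L (-k) x) := by
      refine intervalIntegral.hasSum_integral_of_dominated_convergence
        (fun j _ => ‖pCoeff L f j‖) (fun j => ?_) (fun j => ?_) ?_ ?_ ?_
      · exact ((continuous_const.mul (continuous_expMode L j)).mul
          (continuous_expMode L _)).aestronglyMeasurable
      · refine Eventually.of_forall fun x _ => ?_
        rw [norm_mul, norm_expMode, mul_one]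
        exact hterm j x
      · exact Eventually.of_forall fun x _ => hs
      · simp
      · refine Eventually.of_forall fun x _ => ?_
        exact (Summable.of_norm_bounded hs fun j => hterm j x).hasSum.mul_right _
    have h2 : ∀ j, ∫ x in (-L)..L, pCoeff L f j * expMode L j x * expMode L (-k) x
        = if j = k then pCoeff L f k * (2 * L) else 0 := by
      intro j
      simp only [mul_assoc]
      rw [intervalIntegral.integral_const_mul]
      simp only [expMode_mul_expMode, integral_expMode hL, ← sub_eq_add_neg, sub_eq_zero]
      split_ifs with h
      · rw [h]
      · simp
    simp only [h2] at h1
    have h3 := h1.unique (hasSum_ite_eq k (pCoeff L f k * (2 * L)))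
    have hL' : (L : ℂ) ≠ 0 := by exact_mod_cast hL.ne'
    change (1 / (2 * L) : ℝ) • (∫ x in (-L)..L, F x * expMode L (-k) x) = _
    rw [h3, Complex.real_smul]
    push_cast
    field_simp
  have hFmem : MemLp F 2 (volume.restrict (Ioo (-L) L)) := hFc.memLp_Ioo
  have hP := hasSum_sq_pCoeff hL (hf.sub hFmem)
  have hz : ∀ k, pCoeff L (f - F) k = 0 := fun k => by
    rw [show f - F = fun x => f x - F x from rfl, pCoeff_sub (intervalIntegrable_of_memLp hL hf)
      (intervalIntegrable_of_memLp hL hFmem), hcoef, sub_self]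
  simp only [hz, norm_zero, ne_eq, OfNat.ofNat_ne_zero, not_false_eq_true, zero_pow] at hP
  have hint : ∫ x in (-L)..L, ‖(f - F) x‖ ^ 2 = 0 := by
    have := hP.unique hasSum_zero
    have h2 : (2 * L)⁻¹ ≠ 0 := by positivity
    exact (mul_eq_zero.1 this).resolve_left h2
  rw [intervalIntegral.integral_of_le (by linarith), integral_eq_zero_iff_of_nonneg
    (fun x => sq_nonneg _)] at hint
  · refine ae_eq_of_ae_eq_Ioc hL hper hFper ?_
    filter_upwards [hint] with x hx
    have hx' : ‖(f - F) x‖ ^ 2 = 0 := hx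
    rw [sq_eq_zero_iff, norm_eq_zero] at hx'
    exact sub_eq_zero.1 hx'
  · have := (hf.sub hFmem).integrable_norm_pow (p := 2) (by norm_num)
    rwa [← Measure.restrict_congr_set Ioo_ae_eq_Ioc]

/-- The embedding `H¹_p ⊂ C`: a function in `H¹_p` agrees almost everywhere with a continuous
periodic function, whose supremum is controlled by the `H¹_p` norm. -/
theorem MemSob.exists_continuous_ae_eq {L : ℝ} (hL : 0 < L) {f : ℝ → ℂ} (hf : MemSob L 1 f) :
    ∃ F : ℝ → ℂ, Continuous F ∧ Function.Periodic F (2 * L) ∧ f =ᵐ[volume] F ∧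
      ∀ x, ‖F x‖ ≤ embConst * sobNorm L 1 f := by
  have hs := hf.summable_norm_pCoeff
  have hterm : ∀ k x, ‖pCoeff L f k * expMode L k x‖ ≤ ‖pCoeff L f k‖ := fun k x => by
    rw [norm_mul, norm_expMode, mul_one]
  refine ⟨fun x => ∑' k, pCoeff L f k * expMode L k x,
    continuous_tsum (fun k => continuous_const.mul (continuous_expMode L k)) hs hterm,
    fun x => by simp only [expMode_periodic hL _ x],
    ae_eq_tsum_expMode hL hf.1 hf.2.1 hs, fun x => ?_⟩
  refine (tsum_of_norm_bounded hs.hasSum fun k => hterm k x).trans ?_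
  exact Real.tsum_le_of_sum_le (fun _ => norm_nonneg _) hf.sum_norm_pCoeff_le

theorem MemSob.norm_le_of_continuous {L : ℝ} (hL : 0 < L) {f : ℝ → ℂ} (hf : MemSob L 1 f)
    (hc : Continuous f) (x : ℝ) : ‖f x‖ ≤ embConst * sobNorm L 1 f := by
  obtain ⟨F, hFc, -, hae, hF⟩ := hf.exists_continuous_ae_eq hL
  rw [congrFun ((hc.ae_eq_iff_eq volume hFc).1 hae) x]
  exact hF x

/-! ### The nonlinearity on bounded subsets of `H¹_p` -/

/-- A second order mean value inequality for a `C²` map on a ball, comparing the increments of the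
map along two segments. -/
theorem exists_increment_bound {G : ℂ → ℂ} (hG : ContDiff ℝ 2 G) (R : ℝ) :
    ∃ K : ℝ, 0 ≤ K ∧
      (∀ a b : ℂ, ‖a‖ ≤ R → ‖b‖ ≤ R → ‖G a - G b‖ ≤ K * ‖a - b‖) ∧
      ∀ a b c d : ℂ, ‖a‖ ≤ R → ‖b‖ ≤ R → ‖c‖ ≤ R → ‖d‖ ≤ R → ∀ m : ℝ, ‖a - c‖ ≤ m → ‖b - d‖ ≤ m →
        ‖(G a - G b) - (G c - G d)‖ ≤ K * ‖(a - b) - (c - d)‖ + K * m * ‖c - d‖ := by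
  have hG1 : ContDiff ℝ 1 (fderiv ℝ G) := hG.fderiv_right (by norm_num)
  have hG2 : Continuous (fderiv ℝ (fderiv ℝ G)) := hG1.continuous_fderiv (by norm_num)
  have hcomp : IsCompact (Metric.closedBall (0 : ℂ) R) := isCompact_closedBall 0 R
  have hconv : Convex ℝ (Metric.closedBall (0 : ℂ) R) := convex_closedBall 0 R
  obtain ⟨K1, hK1⟩ := hcomp.exists_bound_of_continuousOn hG1.continuous.continuousOn
  obtain ⟨K2, hK2⟩ := hcomp.exists_bound_of_continuousOn (E := ℂ →L[ℝ] ℂ →L[ℝ] ℂ) hG2.continuousOn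
  set K := max 0 (max K1 K2) with hK
  have hK0 : 0 ≤ K := le_max_left _ _
  have hK1' : ∀ z ∈ Metric.closedBall (0 : ℂ) R, ‖fderiv ℝ G z‖ ≤ K := fun z hz =>
    (hK1 z hz).trans ((le_max_left _ _).trans (le_max_right _ _))
  have hK2' : ∀ z ∈ Metric.closedBall (0 : ℂ) R, ‖fderiv ℝ (fderiv ℝ G) z‖ ≤ K := fun z hz =>
    (hK2 z hz).trans ((le_max_right _ _).trans (le_max_right _ _))
  have hdiff : ∀ z, DifferentiableAt ℝ G z := fun z => (hG.differentiable (by norm_num)) z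
  have hdiff1 : ∀ z, DifferentiableAt ℝ (fderiv ℝ G) z := fun z =>
    (hG1.differentiable (by norm_num)) z
  have mem : ∀ z : ℂ, ‖z‖ ≤ R → z ∈ Metric.closedBall (0 : ℂ) R := fun z hz => by
    simpa using hz
  refine ⟨K, hK0, fun a b ha hb => ?_, fun a b c d ha hb hc hd m hac hbd => ?_⟩
  · exact hconv.norm_image_sub_le_of_norm_fderiv_le (𝕜 := ℝ) (fun z _ => hdiff z) hK1' (mem b hb)
      (mem a ha)
  · -- the path joining `G b - G d` to `G a - G c` along the two segments
    set p : ℝ → ℂ := fun θ => b + θ • (a - b) with hp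
    set q : ℝ → ℂ := fun θ => d + θ • (c - d) with hq
    have hpd : ∀ θ, HasDerivAt p (a - b) θ := fun θ =>
      (((hasDerivAt_id θ).smul_const (a - b)).const_add b).congr_deriv (one_smul _ _)
    have hqd : ∀ θ, HasDerivAt q (c - d) θ := fun θ =>
      (((hasDerivAt_id θ).smul_const (c - d)).const_add d).congr_deriv (one_smul _ _)
    have hpm : ∀ θ ∈ Icc (0 : ℝ) 1, p θ ∈ Metric.closedBall (0 : ℂ) R := fun θ hθ =>
      hconv.add_smul_sub_mem (mem b hb) (mem a ha) hθ
    have hqm : ∀ θ ∈ Icc (0 : ℝ) 1, q θ ∈ Metric.closedBall (0 : ℂ) R := fun θ hθ =>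
      hconv.add_smul_sub_mem (mem d hd) (mem c hc) hθ
    have hD : ∀ θ ∈ Icc (0 : ℝ) 1, HasDerivWithinAt (fun θ => G (p θ) - G (q θ))
        (fderiv ℝ G (p θ) (a - b) - fderiv ℝ G (q θ) (c - d)) (Icc 0 1) θ := fun θ _ =>
      (((hdiff (p θ)).hasFDerivAt.comp_hasDerivAt θ (hpd θ)).sub
        ((hdiff (q θ)).hasFDerivAt.comp_hasDerivAt θ (hqd θ))).hasDerivWithinAt
    have hbound : ∀ θ ∈ Ico (0 : ℝ) 1, ‖fderiv ℝ G (p θ) (a - b) - fderiv ℝ G (q θ) (c - d)‖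
        ≤ K * ‖(a - b) - (c - d)‖ + K * m * ‖c - d‖ := by
      intro θ hθ
      have hθ' : θ ∈ Icc (0 : ℝ) 1 := Ico_subset_Icc_self hθ
      have hpq : ‖p θ - q θ‖ ≤ m := by
        have e : p θ - q θ = (1 - θ) • (b - d) + θ • (a - c) := by
          simp only [hp, hq, Complex.real_smul]
          push_cast
          ring
        rw [e]
        refine (norm_add_le _ _).trans ?_
        rw [norm_smul, norm_smul, Real.norm_of_nonneg hθ.1,
          Real.norm_of_nonneg (by linarith [hθ.2])]
        nlinarith [hθ.1, hθ.2]
      have hlip : ‖fderiv ℝ G (p θ) - fderiv ℝ G (q θ)‖ ≤ K * ‖p θ - q θ‖ :=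
        hconv.norm_image_sub_le_of_norm_fderiv_le (𝕜 := ℝ) (fun z _ => hdiff1 z) hK2' (hqm θ hθ')
          (hpm θ hθ')
      have e : fderiv ℝ G (p θ) (a - b) - fderiv ℝ G (q θ) (c - d)
          = fderiv ℝ G (p θ) ((a - b) - (c - d))
            + (fderiv ℝ G (p θ) - fderiv ℝ G (q θ)) (c - d) := by
        rw [map_sub _ (a - b), sub_apply]
        abel
      rw [e]
      refine (norm_add_le _ _).trans (add_le_add ?_ ?_)
      · exact ((fderiv ℝ G (p θ)).le_opNorm _).trans
          (mul_le_mul_of_nonneg_right (hK1' _ (hpm θ hθ')) (norm_nonneg _))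
      · refine ((fderiv ℝ G (p θ) - fderiv ℝ G (q θ)).le_opNorm _).trans
          (mul_le_mul_of_nonneg_right (hlip.trans ?_) (norm_nonneg _))
        exact mul_le_mul_of_nonneg_left hpq hK0
    have := norm_image_sub_le_of_norm_deriv_le_segment_01' hD hbound
    have e : (G (p 1) - G (q 1)) - (G (p 0) - G (q 0)) = (G a - G b) - (G c - G d) := by
      simp only [hp, hq, one_smul, zero_smul, add_zero, add_sub_cancel]
      abel
    rwa [e] at this

/-- Upper half of the comparison of `|e^{ikπh/L} - 1|` with `|k h|`. -/
theorem norm_expMode_sub_one_le {L : ℝ} (hL : 0 < L) (k : ℤ) (h : ℝ) :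
    ‖expMode L k h - 1‖ ≤ Real.pi / L * (|(k : ℝ)| * |h|) := by
  rw [expMode_eq_exp_ofReal]
  refine Real.norm_exp_I_mul_ofReal_sub_one_le.trans (le_of_eq ?_)
  rw [Real.norm_eq_abs, abs_mul, abs_div, abs_mul, abs_of_pos Real.pi_pos, abs_of_pos hL]
  ring

/-- Lower half of the comparison of `|e^{ikπh/L} - 1|` with `|k h|`, for small steps. -/
theorem le_norm_expMode_sub_one {L : ℝ} (hL : 0 < L) (k : ℤ) (h : ℝ) (hk : |(k : ℝ)| * |h| ≤ L) :
    2 / L * (|(k : ℝ)| * |h|) ≤ ‖expMode L k h - 1‖ := by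
  have hpi := Real.pi_pos
  rw [expMode_eq_exp_ofReal, Complex.norm_exp_I_mul_ofReal_sub_one, norm_mul, Real.norm_eq_abs,
    Real.norm_eq_abs, abs_two]
  have e : |k * Real.pi / L * h / 2| = Real.pi / (2 * L) * (|(k : ℝ)| * |h|) := by
    rw [abs_div, abs_mul, abs_div, abs_mul, abs_of_pos hpi, abs_of_pos hL, abs_two]
    field_simp
  have hle : |k * Real.pi / L * h / 2| ≤ Real.pi / 2 := by
    rw [e]
    calc Real.pi / (2 * L) * (|(k : ℝ)| * |h|) ≤ Real.pi / (2 * L) * L := by gcongr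
      _ = Real.pi / 2 := by field_simp
  have := Real.mul_abs_le_abs_sin hle
  rw [e] at this
  calc 2 / L * (|(k : ℝ)| * |h|)
      = 2 * (2 / Real.pi * (Real.pi / (2 * L) * (|(k : ℝ)| * |h|))) := by field_simp
    _ ≤ _ := mul_le_mul_of_nonneg_left this zero_le_two

theorem hasSum_sq_pCoeff_of_continuous {L : ℝ} (hL : 0 < L) {f : ℝ → ℂ} (hf : Continuous f) :
    HasSum (fun k => ‖pCoeff L f k‖ ^ 2) ((2 * L)⁻¹ * ∫ x in (-L)..L, ‖f x‖ ^ 2) :=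
  hasSum_sq_pCoeff hL hf.memLp_Ioo

theorem pCoeff_increment {L : ℝ} (hL : 0 < L) {f : ℝ → ℂ} (hc : Continuous f)
    (hf : Function.Periodic f (2 * L)) (h : ℝ) (k : ℤ) :
    pCoeff L (fun x => f (x + h) - f x) k = (expMode L k h - 1) * pCoeff L f k := by
  rw [pCoeff_sub, pCoeff_translate hL hf]
  · ring
  · exact (hc.comp (continuous_add_const h)).intervalIntegrable _ _
  · exact hc.intervalIntegrable _ _

/-- The mean square of an increment of an `H¹_p` function is `O(h²)`. -/
theorem MemSob.mean_sq_increment_le {L : ℝ} (hL : 0 < L) {f : ℝ → ℂ} (hf : MemSob L 1 f)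
    (hc : Continuous f) (h : ℝ) :
    (2 * L)⁻¹ * ∫ x in (-L)..L, ‖f (x + h) - f x‖ ^ 2 ≤ (Real.pi / L * |h|) ^ 2 * sobSq L 1 f := by
  have hP := hasSum_sq_pCoeff_of_continuous hL
    ((hc.comp (continuous_add_const h)).sub hc)
  refine hasSum_le (fun k => ?_) hP (hf.2.2.hasSum.mul_left ((Real.pi / L * |h|) ^ 2))
  change ‖pCoeff L (fun x => f (x + h) - f x) k‖ ^ 2 ≤ _
  rw [pCoeff_increment hL hc hf.1, norm_mul, mul_pow, Real.rpow_one]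
  have h1 : ‖expMode L k h - 1‖ ^ 2 ≤ (Real.pi / L * (|(k : ℝ)| * |h|)) ^ 2 :=
    pow_le_pow_left₀ (norm_nonneg _) (norm_expMode_sub_one_le hL k h) 2
  have h2 : (Real.pi / L * (|(k : ℝ)| * |h|)) ^ 2
      ≤ (Real.pi / L * |h|) ^ 2 * (1 + (k : ℝ) ^ 2) := by
    rw [show (Real.pi / L * (|(k : ℝ)| * |h|)) ^ 2
      = (Real.pi / L * |h|) ^ 2 * |(k : ℝ)| ^ 2 by ring,
      sq_abs (k : ℝ)]
    exact mul_le_mul_of_nonneg_left (by linarith) (sq_nonneg _)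
  calc _ ≤ ((Real.pi / L * |h|) ^ 2 * (1 + (k : ℝ) ^ 2)) * ‖pCoeff L f k‖ ^ 2 :=
        mul_le_mul_of_nonneg_right (h1.trans h2) (sq_nonneg _)
    _ = _ := by ring

/-- Conversely, if the mean square of the increments is at most `A h²`, then the coefficients
are controlled in `H¹_p`. -/
theorem sum_sq_pCoeff_le_of_increment {L : ℝ} (hL : 0 < L) {f : ℝ → ℂ} (hc : Continuous f)
    (hf : Function.Periodic f (2 * L)) {A : ℝ}
    (hA : ∀ h, (2 * L)⁻¹ * ∫ x in (-L)..L, ‖f (x + h) - f x‖ ^ 2 ≤ A * h ^ 2) (S : Finset ℤ) :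
    ∑ k ∈ S, (k : ℝ) ^ 2 * ‖pCoeff L f k‖ ^ 2 ≤ (L / 2) ^ 2 * A := by
  -- a step so small that `|e^{ikπh/L} - 1|` is comparable with `|k| h` for all `k ∈ S`
  obtain ⟨B, hB0, hB⟩ : ∃ B : ℝ, 0 < B ∧ ∀ k ∈ S, |(k : ℝ)| ≤ B :=
    ⟨1 + ∑ k ∈ S, |(k : ℝ)|, by positivity, fun k hk =>
      (Finset.single_le_sum (f := fun k : ℤ => |(k : ℝ)|) (fun _ _ => abs_nonneg _) hk).trans
        (by linarith)⟩
  set h := L / B with hh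
  have hh0 : 0 < h := div_pos hL hB0
  have hP := hasSum_sq_pCoeff_of_continuous hL ((hc.comp (continuous_add_const h)).sub hc)
  have h1 := (sum_le_hasSum S (fun _ _ => sq_nonneg _) hP).trans (hA h)
  have h2 : ∀ k ∈ S, (2 / L) ^ 2 * h ^ 2 * ((k : ℝ) ^ 2 * ‖pCoeff L f k‖ ^ 2)
      ≤ ‖pCoeff L (fun x => f (x + h) - f x) k‖ ^ 2 := by
    intro k hk
    have hkL : |(k : ℝ)| * |h| ≤ L := by
      rw [abs_of_pos hh0]
      calc |(k : ℝ)| * h ≤ B * h := mul_le_mul_of_nonneg_right (hB k hk) hh0.le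
        _ = L := by rw [hh]; field_simp
    have h3 := le_norm_expMode_sub_one hL k h hkL
    rw [pCoeff_increment hL hc hf, norm_mul, mul_pow]
    have h4 := pow_le_pow_left₀ (by positivity) h3 2
    calc _ = (2 / L * (|(k : ℝ)| * |h|)) ^ 2 * ‖pCoeff L f k‖ ^ 2 := by
          rw [mul_pow, mul_pow, sq_abs, sq_abs]; ring
      _ ≤ _ := mul_le_mul_of_nonneg_right h4 (sq_nonneg _)
  have h5 := (Finset.sum_le_sum h2).trans h1
  rw [← Finset.mul_sum] at h5
  have hh2 : 0 < h ^ 2 := by positivity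
  have h6 : (2 / L) ^ 2 * (∑ k ∈ S, (k : ℝ) ^ 2 * ‖pCoeff L f k‖ ^ 2) ≤ A := by
    refine le_of_mul_le_mul_right ?_ hh2
    linarith
  calc _ = (L / 2) ^ 2 * ((2 / L) ^ 2 * (∑ k ∈ S, (k : ℝ) ^ 2 * ‖pCoeff L f k‖ ^ 2)) := by
        field_simp
    _ ≤ _ := mul_le_mul_of_nonneg_left h6 (sq_nonneg _)

theorem mean_sq_le_of_le {L : ℝ} (hL : 0 < L) {f g₁ g₂ : ℝ → ℂ} (hf : Continuous f)
    (hg₁ : Continuous g₁) (hg₂ : Continuous g₂) {a b : ℝ}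
    (h : ∀ x, ‖f x‖ ≤ a * ‖g₁ x‖ + b * ‖g₂ x‖) :
    (2 * L)⁻¹ * ∫ x in (-L)..L, ‖f x‖ ^ 2 ≤
      2 * a ^ 2 * ((2 * L)⁻¹ * ∫ x in (-L)..L, ‖g₁ x‖ ^ 2) +
      2 * b ^ 2 * ((2 * L)⁻¹ * ∫ x in (-L)..L, ‖g₂ x‖ ^ 2) := by
  have h1 : ∫ x in (-L)..L, ‖f x‖ ^ 2 ≤
      ∫ x in (-L)..L, (2 * a ^ 2 * ‖g₁ x‖ ^ 2 + 2 * b ^ 2 * ‖g₂ x‖ ^ 2) := by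
    refine intervalIntegral.integral_mono_on (by linarith) ?_ ?_ fun x _ => ?_
    · exact (hf.norm.pow 2).intervalIntegrable _ _
    · exact (((hg₁.norm.pow 2).const_mul _).add ((hg₂.norm.pow 2).const_mul _)).intervalIntegrable
        _ _
    · have := pow_le_pow_left₀ (norm_nonneg _) (h x) 2
      nlinarith [sq_nonneg (a * ‖g₁ x‖ - b * ‖g₂ x‖)]
  rw [intervalIntegral.integral_add, intervalIntegral.integral_const_mul,
    intervalIntegral.integral_const_mul] at h1
  · have h2 : (0 : ℝ) ≤ (2 * L)⁻¹ := by positivity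
    have := mul_le_mul_of_nonneg_left h1 h2
    linarith
  · exact ((hg₁.norm.pow 2).const_mul _).intervalIntegrable _ _
  · exact ((hg₂.norm.pow 2).const_mul _).intervalIntegrable _ _

/-- Superposition with a `C²` map is Lipschitz on bounded subsets of `H¹_p`. The proof compares
increments in `x`, so that no weak derivative has to be taken. -/
theorem exists_superposition_lipschitz {L : ℝ} (hL : 0 < L) {G : ℂ → ℂ} (hG : ContDiff ℝ 2 G)
    (R : ℝ) :
    ∃ K : ℝ, 0 ≤ K ∧ ∀ f g : ℝ → ℂ, MemSob L 1 f → MemSob L 1 g → sobSq L 1 f ≤ R →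
      sobSq L 1 g ≤ R → ∀ S : Finset ℤ,
        ∑ k ∈ S, (1 + (k : ℝ) ^ 2) *
          ‖pCoeff L (fun x => G (f x)) k - pCoeff L (fun x => G (g x)) k‖ ^ 2
          ≤ K * sobSq L 1 (fun x => f x - g x) := by
  obtain ⟨K, hK0, hK1, hK2⟩ := exists_increment_bound hG (embConst * Real.sqrt R)
  refine ⟨2 * K ^ 2 + (L / 2) ^ 2 * (2 * K ^ 2 * (Real.pi / L) ^ 2
    + 2 * (K * embConst) ^ 2 * (Real.pi / L) ^ 2 * |R|), by positivity, ?_⟩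
  intro f₀ g₀ hf₀ hg₀ hfR hgR S
  obtain ⟨f, hfc, hfp, hff, hfb⟩ := hf₀.exists_continuous_ae_eq hL
  obtain ⟨g, hgc, hgp, hgg, hgb⟩ := hg₀.exists_continuous_ae_eq hL
  have hgS : MemSob L 1 g := ⟨hgp, hgc.memLp_Ioo, by simpa only [pCoeff_congr_ae hgg] using hg₀.2.2⟩
  have hfS : MemSob L 1 f := ⟨hfp, hfc.memLp_Ioo, by simpa only [pCoeff_congr_ae hff] using hf₀.2.2⟩
  have hd : (fun x => f₀ x - g₀ x) =ᵐ[volume] fun x => f x - g x := hff.sub hgg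
  have hGf : (fun x => G (f₀ x)) =ᵐ[volume] fun x => G (f x) := hff.fun_comp G
  have hGg : (fun x => G (g₀ x)) =ᵐ[volume] fun x => G (g x) := hgg.fun_comp G
  have hfR' : ∀ x, ‖f x‖ ≤ embConst * Real.sqrt R := fun x => (hfb x).trans
    (mul_le_mul_of_nonneg_left (Real.sqrt_le_sqrt hfR) embConst_nonneg)
  have hgR' : ∀ x, ‖g x‖ ≤ embConst * Real.sqrt R := fun x => (hgb x).trans
    (mul_le_mul_of_nonneg_left (Real.sqrt_le_sqrt hgR) embConst_nonneg)
  rw [sobSq_congr_ae hd]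
  simp only [pCoeff_congr_ae hGf, pCoeff_congr_ae hGg]
  set e : ℝ → ℂ := fun x => f x - g x with he
  have hec : Continuous e := hfc.sub hgc
  have heS : MemSob L 1 e := hfS.sub hL hgS
  set m := embConst * sobNorm L 1 e with hm
  have hem : ∀ x, ‖f x - g x‖ ≤ m := heS.norm_le_of_continuous hL hec
  set D : ℝ → ℂ := fun x => G (f x) - G (g x) with hD
  have hGc : Continuous G := hG.continuous
  have hDc : Continuous D := (hGc.comp hfc).sub (hGc.comp hgc)
  have hDp : Function.Periodic D (2 * L) := fun x => by simp only [hD, hfp x, hgp x]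
  have hDk : ∀ k, pCoeff L (fun x => G (f x)) k - pCoeff L (fun x => G (g x)) k = pCoeff L D k :=
    fun k => (pCoeff_sub ((hGc.comp hfc).intervalIntegrable _ _)
      ((hGc.comp hgc).intervalIntegrable _ _) k).symm
  simp only [hDk]
  have hsq : sobSq L 1 g ≤ |R| := by rw [← sobSq_congr_ae hgg]; exact hgR.trans (le_abs_self R)
  -- the part without derivatives
  have h0 : ∑ k ∈ S, ‖pCoeff L D k‖ ^ 2 ≤ 2 * K ^ 2 * sobSq L 1 e := by
    have h1 := sum_le_hasSum S (fun _ _ => sq_nonneg _) (hasSum_sq_pCoeff_of_continuous hL hDc)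
    refine h1.trans ((mean_sq_le_of_le hL hDc hec hec (a := K) (b := 0) fun x => ?_).trans ?_)
    · rw [zero_mul, add_zero]
      exact hK1 _ _ (hfR' x) (hgR' x)
    · have h2 : (2 * L)⁻¹ * ∫ x in (-L)..L, ‖e x‖ ^ 2 ≤ sobSq L 1 e :=
        hasSum_le (fun k => by
          rw [Real.rpow_one]
          exact le_mul_of_one_le_left (sq_nonneg _) (one_le_weight k))
          (hasSum_sq_pCoeff_of_continuous hL hec) heS.2.2.hasSum
      have := mul_le_mul_of_nonneg_left h2 (by positivity : 0 ≤ 2 * K ^ 2)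
      simpa using this
  -- the increments
  have h1 := sum_sq_pCoeff_le_of_increment hL hDc hDp (A := (2 * K ^ 2 * (Real.pi / L) ^ 2
    + 2 * (K * embConst) ^ 2 * (Real.pi / L) ^ 2 * |R|) * sobSq L 1 e) (fun h => by
    have hst := continuous_add_const h
    refine (mean_sq_le_of_le hL ((hDc.comp hst).sub hDc) ((hec.comp hst).sub hec)
      ((hgc.comp hst).sub hgc) (a := K) (b := K * m) fun x => ?_).trans ?_
    · have := hK2 (f (x + h)) (f x) (g (x + h)) (g x) (hfR' _) (hfR' _) (hgR' _) (hgR' _) m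
        (hem _) (hem _)
      calc ‖D (x + h) - D x‖
          = ‖(G (f (x + h)) - G (f x)) - (G (g (x + h)) - G (g x))‖ := by
            congr 1; simp only [hD]; abel
        _ ≤ _ := this
        _ = K * ‖e (x + h) - e x‖ + K * m * ‖g (x + h) - g x‖ := by
            congr 3; simp only [he]; abel
    · have i1 := heS.mean_sq_increment_le hL hec h
      have i2 := hgS.mean_sq_increment_le hL hgc h
      have i3 : (Real.pi / L * |h|) ^ 2 * sobSq L 1 g ≤ (Real.pi / L * |h|) ^ 2 * |R| :=
        mul_le_mul_of_nonneg_left hsq (sq_nonneg _)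
      have i4 : m ^ 2 = embConst ^ 2 * sobSq L 1 e := by rw [hm, mul_pow, sobNorm_sq]
      have j1 := mul_le_mul_of_nonneg_left i1 (by positivity : 0 ≤ 2 * K ^ 2)
      have j2 := mul_le_mul_of_nonneg_left (i2.trans i3) (by positivity : 0 ≤ 2 * (K * m) ^ 2)
      refine (add_le_add j1 j2).trans (le_of_eq ?_)
      rw [mul_pow K m, i4, mul_pow _ |h|, sq_abs]
      ring) S
  have h2 : ∑ k ∈ S, (1 + (k : ℝ) ^ 2) * ‖pCoeff L D k‖ ^ 2
      = ∑ k ∈ S, ‖pCoeff L D k‖ ^ 2 + ∑ k ∈ S, (k : ℝ) ^ 2 * ‖pCoeff L D k‖ ^ 2 := by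
    rw [← Finset.sum_add_distrib]
    exact Finset.sum_congr rfl fun k _ => by ring
  rw [h2]
  refine (add_le_add h0 h1).trans (le_of_eq ?_)
  ring

/-! ### Convolution with the kernel as a Fourier multiplier -/

theorem conv_apply {E : Type*} [NormedAddCommGroup E] [NormedSpace ℝ E] (β : ℝ → ℝ) (v : ℝ → E)
    (x : ℝ) : conv β v x = ∫ t, β t • v (x - t) := rfl

theorem conv_congr_ae {E : Type*} [NormedAddCommGroup E] [NormedSpace ℝ E] (β : ℝ → ℝ)
    {v w : ℝ → E} (h : v =ᵐ[volume] w) (x : ℝ) : conv β v x = conv β w x := by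
  rw [conv_apply, conv_apply]
  refine integral_congr_ae ?_
  filter_upwards [(Measure.measurePreserving_sub_left volume x).quasiMeasurePreserving.ae h]
    with t ht
  rw [ht]

theorem conv_ofReal (β v : ℝ → ℝ) (x : ℝ) :
    ((conv β v x : ℝ) : ℂ) = conv β (fun y => (v y : ℂ)) x := by
  rw [conv_apply, conv_apply, ← integral_complex_ofReal]
  refine integral_congr_ae (Eventually.of_forall fun t => ?_)
  simp

theorem continuous_conv {β : ℝ → ℝ} (hβ : Integrable β) {v : ℝ → ℂ} (hv : Continuous v) {B : ℝ}
    (hB : ∀ x, ‖v x‖ ≤ B) : Continuous (conv β v) := by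
  refine BddAbove.continuous_convolution_right_of_integrable _ ⟨B, ?_⟩ hβ hv
  rintro _ ⟨x, rfl⟩
  exact hB x

theorem kernelHat_eq (L : ℝ) (β : ℝ → ℝ) (k : ℤ) :
    kernelHat β (k * Real.pi / L) = ∫ t, (β t : ℂ) * expMode L k (-t) := by
  unfold kernelHat expMode
  congr 1
  funext t
  congr 2
  push_cast
  ring

theorem conv_expMode (L : ℝ) (β : ℝ → ℝ) (k : ℤ) (x : ℝ) :
    conv β (expMode L k) x = kernelHat β (k * Real.pi / L) * expMode L k x := by
  rw [conv_apply, kernelHat_eq, ← integral_mul_const]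
  refine integral_congr_ae (Eventually.of_forall fun t => ?_)
  simp only [sub_eq_add_neg, expMode_add, Complex.real_smul]
  ring

theorem conv_trigPoly (L : ℝ) {β : ℝ → ℝ} (hβ : Integrable β) (S : Finset ℤ) (c : ℤ → ℂ)
    (x : ℝ) :
    conv β (fun y => ∑ k ∈ S, c k * expMode L k y) x
      = ∑ k ∈ S, kernelHat β (k * Real.pi / L) * c k * expMode L k x := by
  rw [conv_apply]
  simp only [Finset.smul_sum]
  rw [integral_finsetSum]
  · refine Finset.sum_congr rfl fun k _ => ?_
    rw [mul_comm (kernelHat _ _), mul_assoc, ← conv_expMode, conv_apply, ← integral_const_mul]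
    refine integral_congr_ae (Eventually.of_forall fun t => ?_)
    simp only [Complex.real_smul]
    ring
  · intro k _
    simp only [Complex.real_smul]
    refine (hβ.ofReal (𝕜 := ℂ)).mul_bdd (c := ‖c k‖) ?_ (Eventually.of_forall fun t => ?_)
    · exact (continuous_const.mul ((continuous_expMode L k).comp
        (continuous_const.sub continuous_id))).aestronglyMeasurable
    · rw [norm_mul, norm_expMode, mul_one]

theorem pCoeff_conv {L : ℝ} (hL : 0 < L) {β : ℝ → ℝ} (hβ : Integrable β) {v : ℝ → ℂ}
    (hv : Continuous v) (hp : Function.Periodic v (2 * L)) {B : ℝ} (hB : ∀ x, ‖v x‖ ≤ B) (k : ℤ) :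
    pCoeff L (conv β v) k = kernelHat β (k * Real.pi / L) * pCoeff L v k := by
  have hLL : -L ≤ L := by linarith
  have hfin : IsFiniteMeasure (volume.restrict (Ioc (-L) L)) :=
    ⟨by rw [Measure.restrict_apply_univ]; exact measure_Ioc_lt_top⟩
  have hint : Integrable (Function.uncurry fun x t => (β t : ℂ) * (v (x - t) * expMode L (-k) x))
      ((volume.restrict (Ioc (-L) L)).prod volume) := by
    refine ((hβ.ofReal (𝕜 := ℂ)).comp_snd _).mul_bdd (c := B) ?_ (Eventually.of_forall fun p => ?_)
    · exact ((hv.comp (continuous_fst.sub continuous_snd)).mul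
        ((continuous_expMode L _).comp continuous_fst)).aestronglyMeasurable
    · rw [norm_mul, norm_expMode, mul_one]
      exact hB _
  have h1 : ∫ x in (-L)..L, conv β v x * expMode L (-k) x
      = ∫ t, (β t : ℂ) * ∫ x in (-L)..L, v (x - t) * expMode L (-k) x := by
    simp only [intervalIntegral.integral_of_le hLL, ← integral_const_mul]
    rw [← integral_integral_swap hint]
    refine integral_congr_ae (Eventually.of_forall fun x => ?_)
    simp only [conv_apply, ← integral_mul_const]
    refine integral_congr_ae (Eventually.of_forall fun t => ?_)
    simp only [Complex.real_smul]
    ring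
  have h2 : ∀ t, (β t : ℂ) * ((1 / (2 * L) : ℝ) • ∫ x in (-L)..L, v (x - t) * expMode L (-k) x)
      = (β t : ℂ) * expMode L k (-t) * pCoeff L v k := by
    intro t
    have := pCoeff_translate hL hp (-t) k
    simp only [← sub_eq_add_neg] at this
    rw [mul_assoc, ← this]
    rfl
  rw [kernelHat_eq, ← integral_mul_const]
  simp only [← h2]
  rw [pCoeff, h1, Complex.real_smul, ← integral_const_mul]
  refine integral_congr_ae (Eventually.of_forall fun t => ?_)
  simp only [Complex.real_smul]
  ring

/-! ### Trigonometric polynomials -/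

theorem mem_trigSpace_iff {L : ℝ} (hL : 0 < L) {N : ℕ} {f : ℝ → ℂ} :
    f ∈ trigSpace L N ↔ ∀ x, f x = ∑ k ∈ freqs N, pCoeff L f k * expMode L k x := by
  unfold trigSpace
  rw [Submodule.mem_span_image_finset_iff_exists_fun']
  constructor
  · rintro ⟨c, rfl⟩ x
    have e : (∑ k ∈ freqs N, c k • expMode L k) = fun x => ∑ k ∈ freqs N, c k * expMode L k x := by
      funext x
      simp [Finset.sum_apply]
    rw [e]
    refine Finset.sum_congr rfl fun k hk => ?_
    rw [pCoeff_trigPoly hL, if_pos hk]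
  · intro h
    refine ⟨pCoeff L f, ?_⟩
    funext x
    rw [h x]
    simp [Finset.sum_apply]

theorem trigPoly_mem_trigSpace (L : ℝ) (N : ℕ) (c : ℤ → ℂ) :
    (fun x => ∑ k ∈ freqs N, c k * expMode L k x) ∈ trigSpace L N := by
  unfold trigSpace
  rw [Submodule.mem_span_image_finset_iff_exists_fun']
  refine ⟨c, ?_⟩
  funext x
  simp [Finset.sum_apply]

theorem continuous_trigPoly (L : ℝ) (S : Finset ℤ) (c : ℤ → ℂ) :
    Continuous fun x => ∑ k ∈ S, c k * expMode L k x :=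
  continuous_finsetSum _ fun k _ => continuous_const.mul (continuous_expMode L k)

theorem iteratedDeriv_two_trigPoly (L : ℝ) (S : Finset ℤ) (c : ℤ → ℂ) (x : ℝ) :
    iteratedDeriv 2 (fun y => ∑ k ∈ S, c k * expMode L k y) x
      = ∑ k ∈ S, -((k * Real.pi / L : ℝ) : ℂ) ^ 2 * c k * expMode L k x := by
  have h : ∀ (c : ℤ → ℂ), deriv (fun y => ∑ k ∈ S, c k * expMode L k y)
      = fun y => ∑ k ∈ S, (c k * (Complex.I * k * Real.pi / L)) * expMode L k y := by
    intro c
    funext y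
    have : HasDerivAt (fun y => ∑ k ∈ S, c k * expMode L k y)
        (∑ k ∈ S, c k * (Complex.I * k * Real.pi / L * expMode L k y)) y :=
      HasDerivAt.fun_sum fun k _ => (hasDerivAt_expMode L k y).const_mul (c k)
    rw [this.deriv]
    exact Finset.sum_congr rfl fun k _ => by ring
  rw [iteratedDeriv_succ, iteratedDeriv_one, h, h]
  refine Finset.sum_congr rfl fun k _ => ?_
  push_cast
  linear_combination (c k * expMode L k x * (k * Real.pi / L) ^ 2) * Complex.I_sq

theorem pCoeff_eq_zero_of_mem_trigSpace {L : ℝ} (hL : 0 < L) {N : ℕ} {f : ℝ → ℂ}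
    (hf : f ∈ trigSpace L N) {k : ℤ} (hk : k ∉ freqs N) : pCoeff L f k = 0 := by
  rw [funext ((mem_trigSpace_iff hL).1 hf), pCoeff_trigPoly hL, if_neg hk]

theorem continuous_of_mem_trigSpace {L : ℝ} (hL : 0 < L) {N : ℕ} {f : ℝ → ℂ}
    (hf : f ∈ trigSpace L N) : Continuous f := by
  rw [funext ((mem_trigSpace_iff hL).1 hf)]
  exact continuous_trigPoly L _ _

theorem periodic_of_mem_trigSpace {L : ℝ} (hL : 0 < L) {N : ℕ} {f : ℝ → ℂ}
    (hf : f ∈ trigSpace L N) : Function.Periodic f (2 * L) := by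
  rw [funext ((mem_trigSpace_iff hL).1 hf)]
  intro x
  simp only [expMode_periodic hL _ x]

theorem hasSum_sob_of_mem_trigSpace {L : ℝ} (hL : 0 < L) (s : ℝ) {N : ℕ} {f : ℝ → ℂ}
    (hf : f ∈ trigSpace L N) :
    HasSum (fun k : ℤ => (1 + (k : ℝ) ^ 2) ^ s * ‖pCoeff L f k‖ ^ 2)
      (∑ k ∈ freqs N, (1 + (k : ℝ) ^ 2) ^ s * ‖pCoeff L f k‖ ^ 2) :=
  hasSum_sum_of_ne_finset_zero fun k hk => by
    rw [pCoeff_eq_zero_of_mem_trigSpace hL hf hk]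
    simp

theorem memSob_of_mem_trigSpace {L : ℝ} (hL : 0 < L) (s : ℝ) {N : ℕ} {f : ℝ → ℂ}
    (hf : f ∈ trigSpace L N) : MemSob L s f :=
  ⟨periodic_of_mem_trigSpace hL hf, (continuous_of_mem_trigSpace hL hf).memLp_Ioo,
    (hasSum_sob_of_mem_trigSpace hL s hf).summable⟩

theorem mem_freqs {N : ℕ} {k : ℤ} : k ∈ freqs N ↔ -(N : ℤ) ≤ 2 * k ∧ 2 * k ≤ (N : ℤ) - 2 := by
  unfold freqs
  rw [Finset.mem_filter, Finset.mem_Icc]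
  omega

/-- Sampling at `N + 1` equidistant points recovers the Fourier coefficients of the elements of
`S_N`. -/
theorem exists_sampling {L : ℝ} (hL : 0 < L) (N : ℕ) (k : ℤ) :
    ∃ a : ℕ → ℂ, ∃ y : ℕ → ℝ, ∀ f ∈ trigSpace L N,
      pCoeff L f k = ∑ j ∈ Finset.range (N + 1), a j * f (y j) := by
  by_cases hk : k ∈ freqs N
  swap
  · exact ⟨0, 0, fun f hf => by simp [pCoeff_eq_zero_of_mem_trigSpace hL hf hk]⟩
  have hN0 : ((N + 1 : ℕ) : ℂ) ≠ 0 := by exact_mod_cast Nat.succ_ne_zero N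
  set y : ℕ → ℝ := fun j => 2 * L * j / (N + 1 : ℕ) with hy
  -- discrete orthogonality; two frequencies in `freqs N` differ by less than `N + 1`
  have horth : ∀ m : ℤ, |m| ≤ N → ∑ j ∈ Finset.range (N + 1), expMode L m (y j)
      = if m = 0 then ((N + 1 : ℕ) : ℂ) else 0 := by
    intro m hm
    split_ifs with h0
    · subst h0
      simp [expMode_zero_freq]
    · set z : ℂ := Complex.exp (2 * Real.pi * Complex.I * m / (N + 1 : ℕ)) with hz
      have hL' : (L : ℂ) ≠ 0 := by exact_mod_cast hL.ne'
      have hpow : ∀ j : ℕ, expMode L m (y j) = z ^ j := by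
        intro j
        rw [hz, ← Complex.exp_nat_mul]
        unfold expMode
        congr 1
        simp only [hy]
        push_cast
        field_simp
      simp only [hpow]
      have hzN : z ^ (N + 1) = 1 := by
        rw [hz, ← Complex.exp_nat_mul, Complex.exp_eq_one_iff]
        refine ⟨m, ?_⟩
        field_simp
      have hz1 : z ≠ 1 := by
        intro h
        rw [hz, Complex.exp_eq_one_iff] at h
        obtain ⟨n, hn⟩ := h
        have hpi : (2 * Real.pi * Complex.I : ℂ) ≠ 0 := Complex.two_pi_I_ne_zero
        have h2 : (m : ℂ) = n * (N + 1 : ℕ) := by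
          rw [div_eq_iff hN0] at hn
          apply mul_left_cancel₀ hpi
          rw [hn]
          ring
        have h3 : m = n * (N + 1 : ℕ) := by exact_mod_cast h2
        have h4 : m = 0 := by
          refine Int.eq_zero_of_abs_lt_dvd (m := ((N + 1 : ℕ) : ℤ)) ⟨n, by rw [h3]; ring⟩ ?_
          push_cast
          omega
        exact h0 h4
      rw [geom_sum_eq hz1, hzN, sub_self, zero_div]
  refine ⟨fun j => ((N + 1 : ℕ) : ℂ)⁻¹ * expMode L (-k) (y j), y, fun f hf => ?_⟩
  have h1 : ∀ j, ((N + 1 : ℕ) : ℂ)⁻¹ * expMode L (-k) (y j) * f (y j)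
      = ∑ i ∈ freqs N, ((N + 1 : ℕ) : ℂ)⁻¹ * pCoeff L f i * expMode L (i - k) (y j) := by
    intro j
    rw [(mem_trigSpace_iff hL).1 hf (y j), Finset.mul_sum]
    refine Finset.sum_congr rfl fun i _ => ?_
    rw [sub_eq_add_neg, ← expMode_mul_expMode]
    ring
  simp only [h1]
  rw [Finset.sum_comm]
  simp only [← Finset.mul_sum]
  rw [Finset.sum_eq_single_of_mem k hk]
  · rw [sub_self, horth 0 (by simp), if_pos rfl]
    field_simp
  · intro i hi hik
    rw [mem_freqs] at hi hk
    rw [horth, if_neg (sub_ne_zero.2 hik), mul_zero]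
    rw [abs_le]
    omega

/-- A pointwise differentiable curve in `S_N` has its derivative in `S_N`, and its Fourier
coefficients are differentiable. -/
theorem hasDerivWithinAt_pCoeff_of_trigSpace {L T : ℝ} (hL : 0 < L) (hT : 0 < T) {N : ℕ}
    {w w' : ℝ → ℝ → ℂ} (hw : ∀ t ∈ Icc 0 T, w t ∈ trigSpace L N)
    (hw' : ∀ t ∈ Icc 0 T, ∀ x, HasDerivWithinAt (fun τ => w τ x) (w' t x) (Icc 0 T) t) :
    ∀ t ∈ Icc 0 T, w' t ∈ trigSpace L N ∧
      ∀ k, HasDerivWithinAt (fun τ => pCoeff L (w τ) k) (pCoeff L (w' t) k) (Icc 0 T) t := by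
  intro t ht
  choose a y hay using fun k => exists_sampling hL N k
  set d : ℤ → ℂ := fun k => ∑ j ∈ Finset.range (N + 1), a k j * w' t (y k j) with hd
  have h1 : ∀ k, HasDerivWithinAt (fun τ => pCoeff L (w τ) k) (d k) (Icc 0 T) t := by
    intro k
    have : HasDerivWithinAt (fun τ => ∑ j ∈ Finset.range (N + 1), a k j * w τ (y k j)) (d k)
        (Icc 0 T) t :=
      HasDerivWithinAt.fun_sum fun j _ => (hw' t ht (y k j)).const_mul (a k j)
    exact this.congr (fun τ hτ => hay k _ (hw τ hτ)) (hay k _ (hw t ht))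
  have h2 : w' t = fun x => ∑ k ∈ freqs N, d k * expMode L k x := by
    funext x
    have h3 : HasDerivWithinAt (fun τ => ∑ k ∈ freqs N, pCoeff L (w τ) k * expMode L k x)
        (∑ k ∈ freqs N, d k * expMode L k x) (Icc 0 T) t :=
      HasDerivWithinAt.fun_sum fun k _ => (h1 k).mul_const _
    have h4 := h3.congr (fun τ hτ => (mem_trigSpace_iff hL).1 (hw τ hτ) x)
      ((mem_trigSpace_iff hL).1 (hw t ht) x)
    exact (uniqueDiffOn_Icc hT t ht).eq_deriv _ (hw' t ht x) h4
  have h5 : w' t ∈ trigSpace L N := h2 ▸ trigPoly_mem_trigSpace L N d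
  refine ⟨h5, fun k => ?_⟩
  rw [hay k _ h5]
  exact h1 k

/-! ### `C¹` curves in `H^s_p` as curves in `ℓ²` -/

theorem norm_weighted_pCoeff_sq (L s : ℝ) (f : ℝ → ℂ) (k : ℤ) :
    ‖((1 + (k : ℝ) ^ 2) ^ (s / 2)) • pCoeff L f k‖ ^ 2
      = (1 + (k : ℝ) ^ 2) ^ s * ‖pCoeff L f k‖ ^ 2 := by
  rw [norm_smul, mul_pow, Real.norm_of_nonneg (weight_rpow_pos _ k).le, ← Real.rpow_natCast,
    ← Real.rpow_mul (weight_pos k).le]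
  congr 2
  push_cast
  ring

theorem memℓp_weighted_pCoeff {L s : ℝ} {f : ℝ → ℂ} (hf : MemSob L s f) :
    Memℓp (fun k : ℤ => ((1 + (k : ℝ) ^ 2) ^ (s / 2)) • pCoeff L f k) 2 := by
  refine memℓp_gen ?_
  simp only [ENNReal.toReal_ofNat, Real.rpow_two, norm_weighted_pCoeff_sq]
  exact hf.2.2

open Classical in
/-- The sequence `(1 + k²)^{s/2} f̂_k` as an element of `ℓ²`; zero if it is not in `ℓ²`. -/
noncomputable def sobVec (L s : ℝ) (f : ℝ → ℂ) : lp (fun _ : ℤ => ℂ) 2 :=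
  if h : Memℓp (fun k : ℤ => ((1 + (k : ℝ) ^ 2) ^ (s / 2)) • pCoeff L f k) 2 then ⟨_, h⟩ else 0

theorem MemSob.sobVec_apply {L s : ℝ} {f : ℝ → ℂ} (hf : MemSob L s f) (k : ℤ) :
    sobVec L s f k = ((1 + (k : ℝ) ^ 2) ^ (s / 2)) • pCoeff L f k := by
  unfold sobVec
  rw [dif_pos (memℓp_weighted_pCoeff hf)]

theorem MemSob.norm_sobVec_sq {L s : ℝ} {f : ℝ → ℂ} (hf : MemSob L s f) :
    ‖sobVec L s f‖ ^ 2 = sobSq L s f := by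
  have h := lp.norm_rpow_eq_tsum (p := 2) (by norm_num) (sobVec L s f)
  simp only [ENNReal.toReal_ofNat, Real.rpow_two, hf.sobVec_apply, norm_weighted_pCoeff_sq] at h
  exact h

theorem MemSob.norm_sobVec {L s : ℝ} {f : ℝ → ℂ} (hf : MemSob L s f) :
    ‖sobVec L s f‖ = sobNorm L s f := by
  unfold sobNorm
  rw [← hf.norm_sobVec_sq, Real.sqrt_sq (norm_nonneg _)]

theorem MemSob.sobVec_sub {L s : ℝ} (hL : 0 < L) {f g : ℝ → ℂ} (hf : MemSob L s f)
    (hg : MemSob L s g) :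
    sobVec L s (fun x => f x - g x) = sobVec L s f - sobVec L s g := by
  ext k
  rw [(hf.sub hL hg).sobVec_apply, lp.coeFn_sub, Pi.sub_apply, hf.sobVec_apply, hg.sobVec_apply,
    pCoeff_sub (hf.intervalIntegrable hL) (hg.intervalIntegrable hL), smul_sub]

theorem MemSob.sobVec_div {L s : ℝ} {f : ℝ → ℂ} (hf : MemSob L s f) (c : ℝ) :
    sobVec L s (fun x => f x / (c : ℂ)) = c⁻¹ • sobVec L s f := by
  ext k
  rw [(hf.div_const (c : ℂ)).sobVec_apply, lp.coeFn_smul, Pi.smul_apply, hf.sobVec_apply,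
    pCoeff_div_const, smul_comm]
  congr 1
  rw [Complex.real_smul]
  push_cast
  rw [div_eq_inv_mul]

theorem MemSob.sobNorm_sub_le {L s : ℝ} (hL : 0 < L) {f g : ℝ → ℂ} (hf : MemSob L s f)
    (hg : MemSob L s g) : sobNorm L s (fun x => f x - g x) ≤ sobNorm L s f + sobNorm L s g := by
  rw [← (hf.sub hL hg).norm_sobVec, hf.sobVec_sub hL hg, ← hf.norm_sobVec, ← hg.norm_sobVec]
  exact norm_sub_le _ _

theorem MemSob.pCoeff_eq_eval {L s : ℝ} {f : ℝ → ℂ} (hf : MemSob L s f) (k : ℤ) :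
    pCoeff L f k = ((1 + (k : ℝ) ^ 2) ^ (s / 2))⁻¹ •
      lp.evalCLM ℝ (fun _ : ℤ => ℂ) 2 k (sobVec L s f) := by
  change _ = _ • sobVec L s f k
  rw [hf.sobVec_apply, inv_smul_smul₀ (weight_rpow_pos _ k).ne']

theorem IsC1Sob.hasDerivWithinAt_sobVec {L s T : ℝ} (hL : 0 < L) {w wt : ℝ → ℝ → ℂ}
    (h : IsC1Sob L s T w wt) {t : ℝ} (ht : t ∈ Icc 0 T) :
    HasDerivWithinAt (fun τ => sobVec L s (w τ)) (sobVec L s (wt t)) (Icc 0 T) t := by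
  rw [hasDerivWithinAt_iff_tendsto_slope, tendsto_iff_norm_sub_tendsto_zero]
  refine (h.hasDeriv t ht).congr' ?_
  filter_upwards [self_mem_nhdsWithin] with τ hτ
  have h1 := h.mem τ hτ.1
  have h2 := h.mem t ht
  have h3 := (h1.sub hL h2).div_const ((τ - t : ℝ) : ℂ)
  rw [← (h3.sub hL (h.mem_deriv t ht)).norm_sobVec, h3.sobVec_sub hL (h.mem_deriv t ht),
    (h1.sub hL h2).sobVec_div, h1.sobVec_sub hL h2, slope_def_module]

theorem IsC1Sob.continuousOn_sobVec {L s T : ℝ} (hL : 0 < L) {w wt : ℝ → ℝ → ℂ}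
    (h : IsC1Sob L s T w wt) : ContinuousOn (fun τ => sobVec L s (w τ)) (Icc 0 T) :=
  fun _ ht => (h.hasDerivWithinAt_sobVec hL ht).continuousWithinAt

theorem IsC1Sob.continuousOn_sobVec_deriv {L s T : ℝ} (hL : 0 < L) {w wt : ℝ → ℝ → ℂ}
    (h : IsC1Sob L s T w wt) : ContinuousOn (fun τ => sobVec L s (wt τ)) (Icc 0 T) := by
  intro t ht
  rw [ContinuousWithinAt, tendsto_iff_norm_sub_tendsto_zero]
  refine (h.continuous_deriv t ht).congr' ?_
  filter_upwards [self_mem_nhdsWithin] with τ hτ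
  rw [← ((h.mem_deriv τ hτ).sub hL (h.mem_deriv t ht)).norm_sobVec,
    (h.mem_deriv τ hτ).sobVec_sub hL (h.mem_deriv t ht)]

theorem IsC1Sob.hasDerivWithinAt_pCoeff {L s T : ℝ} (hL : 0 < L) {w wt : ℝ → ℝ → ℂ}
    (h : IsC1Sob L s T w wt) {t : ℝ} (ht : t ∈ Icc 0 T) (k : ℤ) :
    HasDerivWithinAt (fun τ => pCoeff L (w τ) k) (pCoeff L (wt t) k) (Icc 0 T) t := by
  have h1 := (((lp.evalCLM ℝ (fun _ : ℤ => ℂ) 2 k).hasFDerivAt.comp_hasDerivWithinAt t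
    (h.hasDerivWithinAt_sobVec hL ht)).const_smul ((1 + (k : ℝ) ^ 2) ^ (s / 2))⁻¹)
  rw [(h.mem_deriv t ht).pCoeff_eq_eval]
  exact h1.congr (fun τ hτ => (h.mem τ hτ).pCoeff_eq_eval k) ((h.mem t ht).pCoeff_eq_eval k)

theorem IsC1Sob.continuousOn_sobSq {L s T : ℝ} (hL : 0 < L) {w wt : ℝ → ℝ → ℂ}
    (h : IsC1Sob L s T w wt) : ContinuousOn (fun τ => sobSq L s (w τ)) (Icc 0 T) :=
  ((h.continuousOn_sobVec hL).norm.pow 2).congr fun τ hτ => ((h.mem τ hτ).norm_sobVec_sq).symm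

theorem IsC1Sob.continuousOn_sobSq_deriv {L s T : ℝ} (hL : 0 < L) {w wt : ℝ → ℝ → ℂ}
    (h : IsC1Sob L s T w wt) : ContinuousOn (fun τ => sobSq L s (wt τ)) (Icc 0 T) :=
  ((h.continuousOn_sobVec_deriv hL).norm.pow 2).congr fun τ hτ =>
    ((h.mem_deriv τ hτ).norm_sobVec_sq).symm

theorem IsC1Sob.le_xNorm {L s T : ℝ} (hL : 0 < L) {w wt : ℝ → ℝ → ℂ}
    (h : IsC1Sob L s T w wt) {t : ℝ} (ht : t ∈ Icc 0 T) :
    sobSq L s (w t) + sobSq L s (wt t) ≤ xNorm L s T w wt ^ 2 := by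
  have hc : ContinuousOn (fun t => Real.sqrt (sobSq L s (w t) + sobSq L s (wt t))) (Icc 0 T) :=
    ((h.continuousOn_sobSq hL).add (h.continuousOn_sobSq_deriv hL)).sqrt
  have hle := le_csSup (isCompact_Icc.bddAbove_image hc) (mem_image_of_mem _ ht)
  have := pow_le_pow_left₀ (Real.sqrt_nonneg _) hle 2
  rwa [Real.sq_sqrt (add_nonneg (sobSq_nonneg _ _ _) (sobSq_nonneg _ _ _))] at this

theorem sobNorm_le_sobNorm_of_le {L s s' : ℝ} (h : s' ≤ s) {f : ℝ → ℂ} (hf : MemSob L s f) :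
    sobNorm L s' f ≤ sobNorm L s f :=
  Real.sqrt_le_sqrt (hf.sobSq_mono h)

theorem IsC1Sob.mono {L s s' T : ℝ} (hL : 0 < L) (hs : s' ≤ s) {w wt : ℝ → ℝ → ℂ}
    (h : IsC1Sob L s T w wt) : IsC1Sob L s' T w wt where
  mem t ht := (h.mem t ht).mono hs
  mem_deriv t ht := (h.mem_deriv t ht).mono hs
  hasDeriv t ht := by
    refine squeeze_zero' (Eventually.of_forall fun _ => sobNorm_nonneg _ _ _) ?_ (h.hasDeriv t ht)
    filter_upwards [self_mem_nhdsWithin] with τ hτ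
    exact sobNorm_le_sobNorm_of_le hs ((((h.mem τ hτ.1).sub hL (h.mem t ht)).div_const _).sub hL
      (h.mem_deriv t ht))
  continuous_deriv t ht := by
    refine squeeze_zero' (Eventually.of_forall fun _ => sobNorm_nonneg _ _ _) ?_
      (h.continuous_deriv t ht)
    filter_upwards [self_mem_nhdsWithin] with τ hτ
    exact sobNorm_le_sobNorm_of_le hs ((h.mem_deriv τ hτ).sub hL (h.mem_deriv t ht))

theorem IsC1Sob.sub {L s T : ℝ} (hL : 0 < L) {w wt v vt : ℝ → ℝ → ℂ}
    (h : IsC1Sob L s T w wt) (h' : IsC1Sob L s T v vt) :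
    IsC1Sob L s T (fun t x => w t x - v t x) (fun t x => wt t x - vt t x) where
  mem t ht := (h.mem t ht).sub hL (h'.mem t ht)
  mem_deriv t ht := (h.mem_deriv t ht).sub hL (h'.mem_deriv t ht)
  hasDeriv t ht := by
    have h0 := (h.hasDeriv t ht).add (h'.hasDeriv t ht)
    rw [add_zero] at h0
    refine squeeze_zero' (Eventually.of_forall fun _ => sobNorm_nonneg _ _ _) ?_ h0
    filter_upwards [self_mem_nhdsWithin] with τ hτ
    refine le_trans (le_of_eq ?_) (((((h.mem τ hτ.1).sub hL (h.mem t ht)).div_const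
      ((τ - t : ℝ) : ℂ)).sub hL (h.mem_deriv t ht)).sobNorm_sub_le hL
      ((((h'.mem τ hτ.1).sub hL (h'.mem t ht)).div_const ((τ - t : ℝ) : ℂ)).sub hL
        (h'.mem_deriv t ht)))
    congr 1
    funext x
    ring
  continuous_deriv t ht := by
    have h0 := (h.continuous_deriv t ht).add (h'.continuous_deriv t ht)
    rw [add_zero] at h0
    refine squeeze_zero' (Eventually.of_forall fun _ => sobNorm_nonneg _ _ _) ?_ h0
    filter_upwards [self_mem_nhdsWithin] with τ hτ
    refine le_trans (le_of_eq ?_) (((h.mem_deriv τ hτ).sub hL (h.mem_deriv t ht)).sobNorm_sub_le hL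
      ((h'.mem_deriv τ hτ).sub hL (h'.mem_deriv t ht)))
    congr 1
    funext x
    ring

/-- A curve in `S_N` whose Fourier coefficients are `C¹` in time is a `C¹` curve in every
`H^s_p`. -/
theorem isC1Sob_of_trigSpace {L T : ℝ} (hL : 0 < L) (s : ℝ) {N : ℕ} {w wt : ℝ → ℝ → ℂ}
    (hw : ∀ t ∈ Icc 0 T, w t ∈ trigSpace L N) (hwt : ∀ t ∈ Icc 0 T, wt t ∈ trigSpace L N)
    (hd : ∀ t ∈ Icc 0 T, ∀ k,
      HasDerivWithinAt (fun τ => pCoeff L (w τ) k) (pCoeff L (wt t) k) (Icc 0 T) t)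
    (hc : ∀ k, ContinuousOn (fun τ => pCoeff L (wt τ) k) (Icc 0 T)) :
    IsC1Sob L s T w wt := by
  -- on `S_N` the norm is a finite sum, so coefficientwise convergence suffices
  have key : ∀ (l : Filter ℝ) (f : ℝ → ℝ → ℂ), (∀ᶠ τ in l, f τ ∈ trigSpace L N) →
      (∀ k, Tendsto (fun τ => pCoeff L (f τ) k) l (𝓝 0)) →
      Tendsto (fun τ => sobNorm L s (f τ)) l (𝓝 0) := by
    intro l f hf hk
    have h1 : Tendsto (fun τ => Real.sqrt (∑ k ∈ freqs N,
        (1 + (k : ℝ) ^ 2) ^ s * ‖pCoeff L (f τ) k‖ ^ 2)) l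
        (𝓝 (Real.sqrt (∑ k ∈ freqs N, (1 + (k : ℝ) ^ 2) ^ s * ‖(0 : ℂ)‖ ^ 2))) :=
      (tendsto_finsetSum _ fun k _ => ((hk k).norm.pow 2).const_mul _).sqrt
    simp only [norm_zero, ne_eq, OfNat.ofNat_ne_zero, not_false_eq_true, zero_pow, mul_zero,
      Finset.sum_const_zero, Real.sqrt_zero] at h1
    refine h1.congr' ?_
    filter_upwards [hf] with τ hτ
    rw [sobNorm, sobSq, (hasSum_sob_of_mem_trigSpace hL s hτ).tsum_eq]
  have hI : ∀ f ∈ trigSpace L N, IntervalIntegrable f volume (-L) L := fun f hf =>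
    (continuous_of_mem_trigSpace hL hf).intervalIntegrable _ _
  have hdiv : ∀ f ∈ trigSpace L N, ∀ c : ℂ, (fun x => f x / c) ∈ trigSpace L N := fun f hf c => by
    have := (trigSpace L N).smul_mem c⁻¹ hf
    convert this using 1
    funext x
    simp [div_eq_inv_mul]
  have hsub : ∀ f ∈ trigSpace L N, ∀ g ∈ trigSpace L N, (fun x => f x - g x) ∈ trigSpace L N :=
    fun f hf g hg => (trigSpace L N).sub_mem hf hg
  refine ⟨fun t ht => memSob_of_mem_trigSpace hL s (hw t ht),
    fun t ht => memSob_of_mem_trigSpace hL s (hwt t ht), fun t ht => ?_, fun t ht => ?_⟩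
  · refine key _ _ ?_ fun k => ?_
    · filter_upwards [self_mem_nhdsWithin] with τ hτ
      exact hsub _ (hdiv _ (hsub _ (hw τ hτ.1) _ (hw t ht)) _) _ (hwt t ht)
    · have h1 := tendsto_sub_nhds_zero_iff.2 (hasDerivWithinAt_iff_tendsto_slope.1 (hd t ht k))
      refine h1.congr' ?_
      filter_upwards [self_mem_nhdsWithin] with τ hτ
      have h2 := hsub _ (hw τ hτ.1) _ (hw t ht)
      rw [pCoeff_sub (hI _ (hdiv _ h2 _)) (hI _ (hwt t ht)), pCoeff_div_const,
        pCoeff_sub (hI _ (hw τ hτ.1)) (hI _ (hw t ht)), slope_def_module, Complex.real_smul]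
      push_cast
      rw [div_eq_inv_mul]
  · refine key _ _ ?_ fun k => ?_
    · filter_upwards [self_mem_nhdsWithin] with τ hτ
      exact hsub _ (hwt τ hτ) _ (hwt t ht)
    · have h1 := tendsto_sub_nhds_zero_iff.2 (hc k t ht)
      refine h1.congr' ?_
      filter_upwards [self_mem_nhdsWithin] with τ hτ
      rw [pCoeff_sub (hI _ (hwt τ hτ)) (hI _ (hwt t ht))]

/-! ### The equations for the Fourier coefficients -/

/-- The symbol `(kπ/L)² β̂(kπ/L)` of the operator `v ↦ -β * v_xx` on the mode `e^{ikπx/L}`. -/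
noncomputable def symbol (L : ℝ) (β : ℝ → ℝ) (k : ℤ) : ℂ :=
  ((k * Real.pi / L : ℝ) : ℂ) ^ 2 * kernelHat β (k * Real.pi / L)

/-- The common content of the exact equation and of the semi-discrete scheme: `w` is a curve in
`H¹_p` whose Fourier coefficients with frequency in `freqs N` satisfy
`ŵ_k'' = -(kπ/L)² β̂(kπ/L) (ŵ_k + (G(w))^_k)`. -/
structure SolvesModes (L T : ℝ) (β : ℝ → ℝ) (G : ℂ → ℂ) (N : ℕ) (w wt : ℝ → ℝ → ℂ) : Prop where
  mem : ∀ t ∈ Icc 0 T, MemSob L 1 (w t)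
  hasDeriv : ∀ t ∈ Icc 0 T, ∀ k ∈ freqs N,
    HasDerivWithinAt (fun τ => pCoeff L (w τ) k) (pCoeff L (wt t) k) (Icc 0 T) t
  hasDeriv_deriv : ∀ t ∈ Icc 0 T, ∀ k ∈ freqs N,
    HasDerivWithinAt (fun τ => pCoeff L (wt τ) k)
      (-(symbol L β k) * (pCoeff L (w t) k + pCoeff L (fun x => G (w t x)) k)) (Icc 0 T) t

theorem pCoeff_ofReal {L : ℝ} {w : ℝ → ℝ} (hw : IntervalIntegrable w volume (-L) L) (k : ℤ) :
    pCoeff L (fun x => (w x : ℂ)) k = ((1 / (2 * L) : ℝ) : ℂ) *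
      (((∫ x in (-L)..L, w x * Real.cos (k * Real.pi / L * x) : ℝ) : ℂ)
        - Complex.I * ((∫ x in (-L)..L, w x * Real.sin (k * Real.pi / L * x) : ℝ) : ℂ)) := by
  have h1 : ∀ x, (w x : ℂ) * expMode L (-k) x
      = ((w x * Real.cos (k * Real.pi / L * x) : ℝ) : ℂ)
        - Complex.I * ((w x * Real.sin (k * Real.pi / L * x) : ℝ) : ℂ) := by
    intro x
    rw [expMode_eq_exp_ofReal, mul_comm Complex.I, Complex.exp_mul_I, ← Complex.ofReal_cos,
      ← Complex.ofReal_sin,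
      show ((-k : ℤ) : ℝ) * Real.pi / L * x = -(k * Real.pi / L * x) by push_cast; ring,
      Real.cos_neg, Real.sin_neg]
    push_cast
    ring
  have hc : IntervalIntegrable (fun x => w x * Real.cos (k * Real.pi / L * x)) volume (-L) L :=
    hw.mul_continuousOn (by fun_prop)
  have hs : IntervalIntegrable (fun x => w x * Real.sin (k * Real.pi / L * x)) volume (-L) L :=
    hw.mul_continuousOn (by fun_prop)
  unfold pCoeff
  simp only [h1]
  rw [intervalIntegral.integral_sub, intervalIntegral.integral_const_mul,
    intervalIntegral.integral_ofReal, intervalIntegral.integral_ofReal, Complex.real_smul]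
  · exact ⟨hc.1.ofReal, hc.2.ofReal⟩
  · exact IntervalIntegrable.const_mul ⟨hs.1.ofReal, hs.2.ofReal⟩ _

theorem iteratedDeriv_two_cos (a x : ℝ) :
    iteratedDeriv 2 (fun y => Real.cos (a * y)) x = -a ^ 2 * Real.cos (a * x) := by
  have h1 : deriv (fun y => Real.cos (a * y)) = fun y => -Real.sin (a * y) * a := by
    funext y
    simpa using ((hasDerivAt_id y).const_mul a).cos.deriv
  have h2 : HasDerivAt (fun y => -Real.sin (a * y) * a) (-(Real.cos (a * x) * (a * 1)) * a) x :=
    ((hasDerivAt_id x).const_mul a).sin.neg.mul_const a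
  rw [iteratedDeriv_succ, iteratedDeriv_one, h1, h2.deriv]
  ring

theorem iteratedDeriv_two_sin (a x : ℝ) :
    iteratedDeriv 2 (fun y => Real.sin (a * y)) x = -a ^ 2 * Real.sin (a * x) := by
  have h1 : deriv (fun y => Real.sin (a * y)) = fun y => Real.cos (a * y) * a := by
    funext y
    simpa using ((hasDerivAt_id y).const_mul a).sin.deriv
  have h2 : HasDerivAt (fun y => Real.cos (a * y) * a) (-Real.sin (a * x) * (a * 1) * a) x :=
    ((hasDerivAt_id x).const_mul a).cos.mul_const a
  rw [iteratedDeriv_succ, iteratedDeriv_one, h1, h2.deriv]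
  ring

theorem freq_mul_add_period {L : ℝ} (hL : 0 < L) (k : ℤ) (x : ℝ) :
    k * Real.pi / L * (x + 2 * L) = k * Real.pi / L * x + k * (2 * Real.pi) := by
  field_simp

/-- Testing the exact equation with `cos (kπx/L)` and `sin (kπx/L)` gives the equation for the
`k`-th Fourier coefficient. -/
theorem IsSolution.solvesModes {L T : ℝ} (hL : 0 < L) {β : ℝ → ℝ} (hβ : Integrable β)
    {g : ℝ → ℝ} {G : ℂ → ℂ} (hG : Continuous G) (hGg : ∀ x : ℝ, G (x : ℂ) = (g x : ℂ))
    {φ ψ : ℝ → ℝ} {u ut : ℝ → ℝ → ℝ} (hu : IsSolution L T β g φ ψ u ut)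
    (huC : IsC1Sob L 1 T (fun t x => (u t x : ℂ)) (fun t x => (ut t x : ℂ))) (N : ℕ) :
    SolvesModes L T β G N (fun t x => (u t x : ℂ)) (fun t x => (ut t x : ℂ)) where
  mem := huC.mem
  hasDeriv t ht k _ := huC.hasDerivWithinAt_pCoeff hL ht k
  hasDeriv_deriv t ht k _ := by
    set a : ℝ := k * Real.pi / L with ha
    set q : ℝ → ℝ := conv β (fun y => u t y + g (u t y)) with hq
    -- the convolution only sees `u` up to null sets, so `u t` may be replaced by the continuous
    -- representative `F`
    obtain ⟨F, hFc, hFp, hFae, hFb⟩ := (huC.mem t ht).exists_continuous_ae_eq hL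
    have hFi : IntervalIntegrable F volume (-L) L := hFc.intervalIntegrable _ _
    have hGF : Continuous fun x => G (F x) := hG.comp hFc
    have hGFi : IntervalIntegrable (fun x => G (F x)) volume (-L) L := hGF.intervalIntegrable _ _
    set W : ℝ → ℂ := fun x => F x + G (F x) with hW
    have hWc : Continuous W := hFc.add hGF
    have hWp : Function.Periodic W (2 * L) := fun x => by simp only [hW, hFp x]
    obtain ⟨B, hB⟩ : ∃ B, ∀ x, ‖W x‖ ≤ B := by
      obtain ⟨B, hB⟩ := (isCompact_Icc (a := (0 : ℝ)) (b := 2 * L)).exists_bound_of_continuousOn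
        hWc.continuousOn
      refine ⟨B, fun x => ?_⟩
      obtain ⟨y, hy, hxy⟩ := hWp.exists_mem_Ico₀ (by positivity) x
      rw [hxy]
      exact hB y (Ico_subset_Icc_self hy)
    have hqW : (fun x => (q x : ℂ)) = conv β W := by
      funext x
      rw [hq, conv_ofReal]
      refine conv_congr_ae β ?_ x
      filter_upwards [hFae] with y hy
      simp only [hW, ← hy, hGg]
      push_cast
      rfl
    have hqc : Continuous q := by
      have h1 : Continuous fun x => (q x : ℂ) := by
        rw [hqW]; exact continuous_conv hβ hWc hB
      exact Complex.continuous_re.comp h1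
    -- the equation tested with the real and imaginary parts of `e^{ikπx/L}`
    have hcos : HasDerivWithinAt (fun τ => ∫ x in (-L)..L, ut τ x * Real.cos (a * x))
        (∫ x in (-L)..L, q x * iteratedDeriv 2 (fun x => Real.cos (a * x)) x) (Icc 0 T) t :=
      hu.eqn (fun x => Real.cos (a * x))
      (Real.contDiff_cos.comp (contDiff_const.mul contDiff_id))
      (fun x => by simp only [ha, freq_mul_add_period hL, Real.cos_add_int_mul_two_pi]) t ht
    have hsin : HasDerivWithinAt (fun τ => ∫ x in (-L)..L, ut τ x * Real.sin (a * x))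
        (∫ x in (-L)..L, q x * iteratedDeriv 2 (fun x => Real.sin (a * x)) x) (Icc 0 T) t :=
      hu.eqn (fun x => Real.sin (a * x))
      (Real.contDiff_sin.comp (contDiff_const.mul contDiff_id))
      (fun x => by simp only [ha, freq_mul_add_period hL, Real.sin_add_int_mul_two_pi]) t ht
    simp only [iteratedDeriv_two_cos] at hcos
    simp only [iteratedDeriv_two_sin] at hsin
    have hd := (hcos.ofReal_comp.sub (hsin.ofReal_comp.const_mul Complex.I)).const_mul
      ((1 / (2 * L) : ℝ) : ℂ)
    have hre : ∀ τ ∈ Icc 0 T, IntervalIntegrable (ut τ) volume (-L) L := fun τ hτ => by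
      have h1 := (huC.mem_deriv τ hτ).intervalIntegrable hL
      exact ⟨h1.1.re, h1.2.re⟩
    refine (hd.congr (fun τ hτ => pCoeff_ofReal (hre τ hτ) k)
      (pCoeff_ofReal (hre t ht) k)).congr_deriv ?_
    have hGae : (fun x => G (u t x : ℂ)) =ᵐ[volume] fun x => G (F x) := hFae.fun_comp G
    have hsum : pCoeff L (fun x => (u t x : ℂ)) k + pCoeff L (fun x => G (u t x : ℂ)) k
        = pCoeff L W k := by
      rw [pCoeff_congr_ae hFae, pCoeff_congr_ae hGae, ← pCoeff_add hFi hGFi]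
    have hqk := pCoeff_ofReal (hqc.intervalIntegrable (-L) L) k
    rw [hqW, pCoeff_conv hL hβ hWc hWp hB] at hqk
    have e1 : ∀ x, q x * (-a ^ 2 * Real.cos (a * x)) = -a ^ 2 * (q x * Real.cos (a * x)) :=
      fun x => by ring
    have e2 : ∀ x, q x * (-a ^ 2 * Real.sin (a * x)) = -a ^ 2 * (q x * Real.sin (a * x)) :=
      fun x => by ring
    simp only [e1, e2, intervalIntegral.integral_const_mul]
    rw [← ha] at hqk
    rw [hsum, symbol, ← ha, Complex.ofReal_mul, Complex.ofReal_mul, Complex.ofReal_neg,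
      Complex.ofReal_pow]
    linear_combination (a : ℂ) ^ 2 * hqk

/-- A solution of the semi-discrete scheme is a `C¹` curve in every `H^s_p`. -/
theorem IsSemiDiscrete.isC1Sob {L T : ℝ} (hL : 0 < L) (hT : 0 < T) {N : ℕ} {β : ℝ → ℝ}
    (hβ : Integrable β) {G : ℂ → ℂ} {φ ψ : ℝ → ℝ} {v vt : ℝ → ℝ → ℂ}
    (hv : IsSemiDiscrete L T N β G φ ψ v vt) (s : ℝ) :
    IsC1Sob L s T v vt ∧ SolvesModes L T β G N v vt := by
  have h1 := hasDerivWithinAt_pCoeff_of_trigSpace hL hT hv.mem hv.hasDeriv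
  have h2 := hasDerivWithinAt_pCoeff_of_trigSpace hL hT (fun t ht => (h1 t ht).1) hv.eqn
  refine ⟨isC1Sob_of_trigSpace hL s hv.mem (fun t ht => (h1 t ht).1) (fun t ht => (h1 t ht).2)
    fun k t ht => ((h2 t ht).2 k).continuousWithinAt,
    fun t ht => memSob_of_mem_trigSpace hL 1 (hv.mem t ht), fun t ht k _ => (h1 t ht).2 k,
    fun t ht k hk => ((h2 t ht).2 k).congr_deriv ?_⟩
  have e1 : (fun y => iteratedDeriv 2 (v t) y + iteratedDeriv 2 (proj L N fun z => G (v t z)) y)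
      = fun y => ∑ k ∈ freqs N, (-((k * Real.pi / L : ℝ) : ℂ) ^ 2 *
          (pCoeff L (v t) k + pCoeff L (fun x => G (v t x)) k)) * expMode L k y := by
    funext y
    have e2 : proj L N (fun z => G (v t z))
        = fun y => ∑ k ∈ freqs N, pCoeff L (fun x => G (v t x)) k * expMode L k y := rfl
    rw [e2, iteratedDeriv_two_trigPoly]
    nth_rw 1 [funext ((mem_trigSpace_iff hL).1 (hv.mem t ht))]
    rw [iteratedDeriv_two_trigPoly, ← Finset.sum_add_distrib]
    exact Finset.sum_congr rfl fun k _ => by ring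
  rw [e1, funext (conv_trigPoly L hβ _ _), pCoeff_trigPoly hL, if_pos hk, symbol]
  ring

/-! ### The part of the norm outside the retained frequencies -/

/-- The part `∑ (1 + k²)^s |f̂_k|²` of `‖f‖_s²` over the frequencies outside `freqs N`, which is
`‖f - P_N f‖_s²`. -/
noncomputable def tailSq (L s : ℝ) (N : ℕ) (f : ℝ → ℂ) : ℝ :=
  sobSq L s f - ∑ k ∈ freqs N, (1 + (k : ℝ) ^ 2) ^ s * ‖pCoeff L f k‖ ^ 2

theorem sobSq_sub_of_mem_trigSpace {L s : ℝ} (hL : 0 < L) {N : ℕ} {w v : ℝ → ℂ}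
    (hw : MemSob L s w) (hv : v ∈ trigSpace L N) :
    sobSq L s (fun x => w x - v x)
      = ∑ k ∈ freqs N, (1 + (k : ℝ) ^ 2) ^ s * ‖pCoeff L w k - pCoeff L v k‖ ^ 2
        + tailSq L s N w := by
  have hv' := memSob_of_mem_trigSpace hL s hv
  have h1 : HasSum (fun k : ℤ => (1 + (k : ℝ) ^ 2) ^ s * ‖pCoeff L w k - pCoeff L v k‖ ^ 2
      - (1 + (k : ℝ) ^ 2) ^ s * ‖pCoeff L w k‖ ^ 2)
      (∑ k ∈ freqs N, ((1 + (k : ℝ) ^ 2) ^ s * ‖pCoeff L w k - pCoeff L v k‖ ^ 2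
      - (1 + (k : ℝ) ^ 2) ^ s * ‖pCoeff L w k‖ ^ 2)) :=
    hasSum_sum_of_ne_finset_zero fun k hk => by
      rw [pCoeff_eq_zero_of_mem_trigSpace hL hv hk, sub_zero, sub_self]
  have h2 := h1.add hw.2.2.hasSum
  simp only [sub_add_cancel] at h2
  unfold sobSq
  simp only [pCoeff_sub (hw.intervalIntegrable hL) (hv'.intervalIntegrable hL)]
  rw [h2.tsum_eq, tailSq, sobSq, Finset.sum_sub_distrib]
  ring

theorem tailSq_eq_zero_of_mem_trigSpace {L : ℝ} (hL : 0 < L) (s : ℝ) {N : ℕ} {v : ℝ → ℂ}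
    (hv : v ∈ trigSpace L N) : tailSq L s N v = 0 := by
  rw [tailSq, sobSq, (hasSum_sob_of_mem_trigSpace hL s hv).tsum_eq, sub_self]

theorem tailSq_nonneg {L s : ℝ} {f : ℝ → ℂ} (hf : MemSob L s f) (N : ℕ) : 0 ≤ tailSq L s N f :=
  sub_nonneg.2 (hf.2.2.sum_le_tsum _ fun k _ => sobTerm_nonneg L s f k)

/-- The discarded frequencies satisfy `|k| ≥ (N - 1)/2`; the summand `1` in the weight takes care of
`N = 1`, where `freqs N` is empty and `k = 0` is discarded as well. -/
theorem sq_le_weight_of_notMem_freqs {N : ℕ} (hN : 0 < N) {k : ℤ} (hk : k ∉ freqs N) :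
    (N : ℝ) ^ 2 / 16 ≤ 1 + (k : ℝ) ^ 2 := by
  rw [mem_freqs] at hk
  have h1 : (N : ℤ) ≤ 2 * |k| + 1 := by
    rcases abs_cases k with ⟨h, _⟩ | ⟨h, _⟩ <;> rw [h] <;> omega
  have h2 : (N : ℝ) ≤ 2 * |(k : ℝ)| + 1 := by exact_mod_cast h1
  have h3 : (0 : ℝ) < N := by exact_mod_cast hN
  nlinarith [sq_abs (k : ℝ), abs_nonneg (k : ℝ), sq_nonneg (|(k : ℝ)| - 1)]

/-- The projection error: `‖f - P_N f‖_{s'}² ≤ (N²/16)^{s'-s} ‖f‖_s²` for `s' ≤ s`. -/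
theorem tailSq_le {L s s' : ℝ} (hs : s' ≤ s) {N : ℕ} (hN : 0 < N) {f : ℝ → ℂ}
    (hf : MemSob L s f) :
    tailSq L s' N f ≤ ((N : ℝ) ^ 2 / 16) ^ (s' - s) * sobSq L s f := by
  have hN' : (0 : ℝ) < (N : ℝ) ^ 2 / 16 := by positivity
  have hA : 0 ≤ ((N : ℝ) ^ 2 / 16) ^ (s' - s) := (Real.rpow_pos_of_pos hN' _).le
  have h1 := (hf.mono hs).2.2.hasSum
  have h2 : HasSum (fun k : ℤ => if k ∈ freqs N then
      (1 + (k : ℝ) ^ 2) ^ s' * ‖pCoeff L f k‖ ^ 2 else 0)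
      (∑ k ∈ freqs N, (1 + (k : ℝ) ^ 2) ^ s' * ‖pCoeff L f k‖ ^ 2) := by
    have h : HasSum (fun k : ℤ => if k ∈ freqs N then
        (1 + (k : ℝ) ^ 2) ^ s' * ‖pCoeff L f k‖ ^ 2 else 0)
        (∑ k ∈ freqs N, if k ∈ freqs N then
          (1 + (k : ℝ) ^ 2) ^ s' * ‖pCoeff L f k‖ ^ 2 else 0) :=
      hasSum_sum_of_ne_finset_zero fun k hk => if_neg hk
    rwa [Finset.sum_congr rfl fun k hk => if_pos hk] at h
  refine hasSum_le (fun k => ?_) (h1.sub h2) (hf.2.2.hasSum.mul_left _)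
  split_ifs with hk
  · rw [sub_self]
    exact mul_nonneg hA (sobTerm_nonneg L s f k)
  · rw [sub_zero, ← mul_assoc]
    refine mul_le_mul_of_nonneg_right ?_ (sq_nonneg _)
    have h3 : (1 + (k : ℝ) ^ 2) ^ s' = (1 + (k : ℝ) ^ 2) ^ (s' - s) * (1 + (k : ℝ) ^ 2) ^ s := by
      rw [← Real.rpow_add (weight_pos k), sub_add_cancel]
    rw [h3]
    exact mul_le_mul_of_nonneg_right (Real.rpow_le_rpow_of_nonpos hN'
      (sq_le_weight_of_notMem_freqs hN hk) (by linarith)) (weight_rpow_pos s k).le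

theorem freqs_mono : Monotone freqs := fun M N h k hk => by
  rw [mem_freqs] at hk ⊢
  omega

theorem tendsto_freqs_atTop : Tendsto freqs atTop atTop := by
  refine tendsto_atTop_finset_of_monotone freqs_mono fun k => ⟨2 * k.natAbs + 2, ?_⟩
  rw [mem_freqs]
  omega

/-- The projection error of a continuous curve in `H^s_p` tends to zero uniformly in time, by
Dini's theorem. -/
theorem IsC1Sob.eventually_tailSq_le {L s T : ℝ} (hL : 0 < L) {w wt : ℝ → ℝ → ℂ}
    (h : IsC1Sob L s T w wt) {δ : ℝ} (hδ : 0 < δ) :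
    ∀ᶠ N in atTop, ∀ t ∈ Icc 0 T, tailSq L s N (w t) ≤ δ := by
  have h1 : TendstoUniformlyOn
      (fun N t => ∑ k ∈ freqs N, (1 + (k : ℝ) ^ 2) ^ s * ‖pCoeff L (w t) k‖ ^ 2)
      (fun t => sobSq L s (w t)) atTop (Icc 0 T) := by
    refine Monotone.tendstoUniformlyOn_of_forall_tendsto isCompact_Icc (fun N => ?_)
      (fun t _ M N hMN => ?_) (h.continuousOn_sobSq hL) fun t ht => ?_
    · refine continuousOn_finsetSum _ fun k _ => ContinuousOn.mul continuousOn_const ?_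
      exact ContinuousOn.pow (fun t ht =>
        (h.hasDerivWithinAt_pCoeff hL ht k).continuousWithinAt.norm) 2
    · exact Finset.sum_le_sum_of_subset_of_nonneg (freqs_mono hMN)
        fun k _ _ => sobTerm_nonneg L s (w t) k
    · exact (h.mem t ht).2.2.hasSum.comp tendsto_freqs_atTop
  filter_upwards [Metric.tendstoUniformlyOn_iff.1 h1 δ hδ] with N hN t ht
  have := hN t ht
  rw [Real.dist_eq] at this
  exact ((le_abs_self _).trans_lt this).le

/-! ### The energy estimate -/

/-- Under the decay of the kernel, `|symbol|² (1 + k²)^{r/2} ≤ C (1 + k²)`. This is where `r ≥ 2`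
enters: the energy at the level `r/2` only sees the nonlinearity in `H¹_p`. -/
theorem exists_symbol_bound {L : ℝ} (hL : 0 < L) {r : ℝ} (hr : 2 ≤ r) {β : ℝ → ℝ} {Cβ : ℝ}
    (hβ : ∀ k : ℝ, (kernelHat β k).im = 0 ∧ 0 ≤ (kernelHat β k).re ∧
      (kernelHat β k).re ≤ Cβ * (1 + k ^ 2) ^ (-(r / 2))) :
    ∃ C : ℝ, 0 ≤ C ∧ ∀ k : ℤ,
      (1 + (k : ℝ) ^ 2) ^ (r / 2) * ‖symbol L β k‖ ^ 2 ≤ C * (1 + (k : ℝ) ^ 2) := by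
  set c : ℝ := Real.pi / L with hc
  have hc0 : 0 < c := div_pos Real.pi_pos hL
  set m : ℝ := min 1 (c ^ 2) with hm
  have hm0 : 0 < m := lt_min one_pos (by positivity)
  refine ⟨(c ^ 2 * |Cβ| * m ^ (-(r / 2))) ^ 2, sq_nonneg _, fun k => ?_⟩
  set q : ℝ := 1 + (k : ℝ) ^ 2 with hq
  have hq1 : 1 ≤ q := one_le_weight k
  have hq0 : 0 < q := weight_pos k
  set b := kernelHat β (k * Real.pi / L) with hb
  obtain ⟨h1, h2, h3⟩ := hβ (k * Real.pi / L)
  have hnorm : ‖b‖ = b.re := by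
    have : b = (b.re : ℂ) := Complex.ext rfl (by rw [Complex.ofReal_im]; exact h1)
    rw [this, Complex.norm_real, Real.norm_of_nonneg h2, Complex.ofReal_re]
  have hmq : m * q ≤ 1 + (k * Real.pi / L) ^ 2 := by
    have e : (k * Real.pi / L) ^ 2 = c ^ 2 * (k : ℝ) ^ 2 := by rw [hc]; ring
    rw [e, hq, mul_add, mul_one]
    exact add_le_add (min_le_left _ _)
      (mul_le_mul_of_nonneg_right (min_le_right _ _) (sq_nonneg _))
  have h4 : (1 + (k * Real.pi / L) ^ 2) ^ (-(r / 2)) ≤ m ^ (-(r / 2)) * q ^ (-(r / 2)) := by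
    rw [← Real.mul_rpow hm0.le hq0.le]
    exact Real.rpow_le_rpow_of_nonpos (mul_pos hm0 hq0) hmq (by linarith)
  have h5 : ‖b‖ ≤ |Cβ| * (m ^ (-(r / 2)) * q ^ (-(r / 2))) := by
    rw [hnorm]
    refine h3.trans (mul_le_mul (le_abs_self _) h4 ?_ (abs_nonneg _))
    exact Real.rpow_nonneg (by positivity) _
  have h6 : ‖symbol L β k‖ ≤ c ^ 2 * |Cβ| * m ^ (-(r / 2)) * (q * q ^ (-(r / 2))) := by
    rw [symbol, norm_mul, norm_pow, Complex.norm_real, Real.norm_eq_abs, sq_abs]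
    have e : (k * Real.pi / L) ^ 2 = c ^ 2 * (k : ℝ) ^ 2 := by rw [hc]; ring
    have h7 : (k * Real.pi / L) ^ 2 ≤ c ^ 2 * q := by
      rw [e]; exact mul_le_mul_of_nonneg_left (by rw [hq]; linarith) (sq_nonneg _)
    calc _ ≤ (c ^ 2 * q) * (|Cβ| * (m ^ (-(r / 2)) * q ^ (-(r / 2)))) :=
          mul_le_mul h7 h5 (norm_nonneg _) (by positivity)
      _ = _ := by ring
  have h7 : q ^ (r / 2) * (q * q ^ (-(r / 2))) ^ 2 ≤ q := by
    have e : q ^ (r / 2) * (q * q ^ (-(r / 2))) ^ 2 = q ^ (2 - r / 2) := by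
      have e1 : q ^ (r / 2) * q ^ (-(r / 2)) = 1 := by
        rw [← Real.rpow_add hq0, add_neg_cancel, Real.rpow_zero]
      have e2 : q ^ (2 - r / 2) = q ^ 2 * q ^ (-(r / 2)) := by
        rw [sub_eq_add_neg, Real.rpow_add hq0, Real.rpow_two]
      rw [e2]
      linear_combination (q ^ 2 * q ^ (-(r / 2))) * e1
    rw [e]
    exact (Real.rpow_le_rpow_of_exponent_le hq1 (by linarith : 2 - r / 2 ≤ 1)).trans_eq
      (Real.rpow_one q)
  calc q ^ (r / 2) * ‖symbol L β k‖ ^ 2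
      ≤ q ^ (r / 2) * (c ^ 2 * |Cβ| * m ^ (-(r / 2)) * (q * q ^ (-(r / 2)))) ^ 2 :=
        mul_le_mul_of_nonneg_left (pow_le_pow_left₀ (norm_nonneg _) h6 2)
          (Real.rpow_nonneg hq0.le _)
    _ = (c ^ 2 * |Cβ| * m ^ (-(r / 2))) ^ 2 * (q ^ (r / 2) * (q * q ^ (-(r / 2))) ^ 2) := by ring
    _ ≤ _ := mul_le_mul_of_nonneg_left h7 (sq_nonneg _)

/-- The squared distance at time `t` of `(w, w_t)` and `(v, v_t)` in `H^s_p`, restricted to the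
frequencies in `freqs N`. -/
noncomputable def modeEnergy (L s : ℝ) (N : ℕ) (w wt v vt : ℝ → ℝ → ℂ) (t : ℝ) : ℝ :=
  ∑ k ∈ freqs N, (1 + (k : ℝ) ^ 2) ^ s *
    (‖pCoeff L (w t) k - pCoeff L (v t) k‖ ^ 2 + ‖pCoeff L (wt t) k - pCoeff L (vt t) k‖ ^ 2)

theorem modeEnergy_nonneg (L s : ℝ) (N : ℕ) (w wt v vt : ℝ → ℝ → ℂ) (t : ℝ) :
    0 ≤ modeEnergy L s N w wt v vt t :=
  Finset.sum_nonneg fun k _ => mul_nonneg (weight_rpow_pos s k).le (by positivity)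

theorem modeEnergy_eq (L s : ℝ) (N : ℕ) (w wt v vt : ℝ → ℝ → ℂ) (t : ℝ) :
    modeEnergy L s N w wt v vt t =
      ∑ k ∈ freqs N, (1 + (k : ℝ) ^ 2) ^ s * ‖pCoeff L (w t) k - pCoeff L (v t) k‖ ^ 2 +
      ∑ k ∈ freqs N, (1 + (k : ℝ) ^ 2) ^ s * ‖pCoeff L (wt t) k - pCoeff L (vt t) k‖ ^ 2 := by
  simp only [modeEnergy, mul_add, Finset.sum_add_distrib]

theorem two_mul_inner_le (a b : ℂ) : 2 * inner ℝ a b ≤ ‖a‖ ^ 2 + ‖b‖ ^ 2 := by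
  nlinarith [real_inner_le_norm a b, sq_nonneg (‖a‖ - ‖b‖)]

theorem norm_add_sq_le_two (a b : ℂ) : ‖a + b‖ ^ 2 ≤ 2 * (‖a‖ ^ 2 + ‖b‖ ^ 2) := by
  have := norm_add_le a b
  nlinarith [sq_nonneg (‖a‖ - ‖b‖), norm_nonneg (a + b), norm_nonneg a, norm_nonneg b]

/-- As long as `w` and the energy stay bounded by `R`, the energy grows at most at a rate
controlled by itself and by the projection error of `w`. -/
theorem exists_modeEnergy_deriv_le {L : ℝ} (hL : 0 < L) {T : ℝ} (hT : 0 < T) {r : ℝ} (hr : 2 ≤ r)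
    {β : ℝ → ℝ} {Cβ : ℝ}
    (hβ : ∀ k : ℝ, (kernelHat β k).im = 0 ∧ 0 ≤ (kernelHat β k).re ∧
      (kernelHat β k).re ≤ Cβ * (1 + k ^ 2) ^ (-(r / 2)))
    {G : ℂ → ℂ} (hG : ContDiff ℝ 2 G) (R : ℝ) :
    ∃ K : ℝ, 0 ≤ K ∧ ∀ (N : ℕ) (w wt v vt : ℝ → ℝ → ℂ), SolvesModes L T β G N w wt →
      SolvesModes L T β G N v vt → (∀ t ∈ Icc 0 T, v t ∈ trigSpace L N) →
      (∀ t ∈ Icc 0 T, MemSob L (r / 2) (w t)) → ∀ t ∈ Icc 0 T,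
        DifferentiableWithinAt ℝ (modeEnergy L (r / 2) N w wt v vt) (Icc 0 T) t ∧
        (sobSq L (r / 2) (w t) ≤ R → modeEnergy L (r / 2) N w wt v vt t ≤ R →
          derivWithin (modeEnergy L (r / 2) N w wt v vt) (Icc 0 T) t ≤
            K * (modeEnergy L (r / 2) N w wt v vt t + tailSq L (r / 2) N (w t))) := by
  obtain ⟨C, hC0, hC⟩ := exists_symbol_bound hL hr hβ
  obtain ⟨K, hK0, hK⟩ := exists_superposition_lipschitz hL hG (4 * R)
  refine ⟨2 + 2 * C + 2 * C * K, by positivity, ?_⟩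
  intro N w wt v vt hw hv hvN hwm t ht
  have hr1 : (1 : ℝ) ≤ r / 2 := by linarith
  set θ : ℤ → ℂ := fun k => pCoeff L (w t) k - pCoeff L (v t) k with hθ
  set θ' : ℤ → ℂ := fun k => pCoeff L (wt t) k - pCoeff L (vt t) k with hθ'
  set Δ : ℤ → ℂ := fun k => pCoeff L (fun x => G (w t x)) k - pCoeff L (fun x => G (v t x)) k
    with hΔ
  set θ'' : ℤ → ℂ := fun k => -(symbol L β k) * (θ k + Δ k) with hθ''
  set ω : ℤ → ℝ := fun k => (1 + (k : ℝ) ^ 2) ^ (r / 2) with hω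
  have hω0 : ∀ k, 0 ≤ ω k := fun k => (weight_rpow_pos _ k).le
  have hω1 : ∀ k : ℤ, 1 + (k : ℝ) ^ 2 ≤ ω k := fun k => by
    have := weight_rpow_mono hr1 k
    rwa [Real.rpow_one] at this
  set E := modeEnergy L (r / 2) N w wt v vt with hE
  have hEt : E t = ∑ k ∈ freqs N, ω k * (‖θ k‖ ^ 2 + ‖θ' k‖ ^ 2) := rfl
  have hderiv : HasDerivWithinAt E (∑ k ∈ freqs N, ω k *
      (2 * inner ℝ (θ k) (θ' k) + 2 * inner ℝ (θ' k) (θ'' k))) (Icc 0 T) t := by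
    refine HasDerivWithinAt.fun_sum fun k hk => HasDerivWithinAt.const_mul _ ?_
    refine HasDerivWithinAt.add ((hw.hasDeriv t ht k hk).sub (hv.hasDeriv t ht k hk)).norm_sq ?_
    refine (((hw.hasDeriv_deriv t ht k hk).sub (hv.hasDeriv_deriv t ht k hk)).congr_deriv
      ?_).norm_sq
    simp only [hθ'', hθ, hΔ]
    ring
  refine ⟨hderiv.differentiableWithinAt, fun hwR hER => ?_⟩
  rw [hderiv.derivWithin (uniqueDiffOn_Icc hT t ht)]
  -- the low frequency part of the distance is bounded by the energy
  have hθE : ∑ k ∈ freqs N, ω k * ‖θ k‖ ^ 2 ≤ E t := by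
    rw [hEt]
    exact Finset.sum_le_sum fun k _ => mul_le_mul_of_nonneg_left
      (le_add_of_nonneg_right (sq_nonneg _)) (hω0 k)
  have hvt := hvN t ht
  have hvR : sobSq L 1 (v t) ≤ 4 * R := by
    refine ((memSob_of_mem_trigSpace hL (r / 2) hvt).sobSq_mono hr1).trans ?_
    rw [sobSq, (hasSum_sob_of_mem_trigSpace hL (r / 2) hvt).tsum_eq]
    have h1 : ∑ k ∈ freqs N, ω k * ‖pCoeff L (v t) k‖ ^ 2 ≤
        ∑ k ∈ freqs N, (2 * (ω k * ‖pCoeff L (w t) k‖ ^ 2) + 2 * (ω k * ‖θ k‖ ^ 2)) := by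
      refine Finset.sum_le_sum fun k _ => ?_
      have h2 := norm_add_sq_le_two (pCoeff L (w t) k) (-θ k)
      rw [norm_neg, show pCoeff L (w t) k + -θ k = pCoeff L (v t) k by simp only [hθ]; ring] at h2
      have := mul_le_mul_of_nonneg_left h2 (hω0 k)
      linarith
    rw [Finset.sum_add_distrib, ← Finset.mul_sum, ← Finset.mul_sum] at h1
    have h3 : ∑ k ∈ freqs N, ω k * ‖pCoeff L (w t) k‖ ^ 2 ≤ sobSq L (r / 2) (w t) :=
      (hwm t ht).2.2.sum_le_tsum _ fun k _ => sobTerm_nonneg L _ (w t) k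
    linarith
  have hwR' : sobSq L 1 (w t) ≤ 4 * R := by
    have h1 := (hwm t ht).sobSq_mono hr1
    have h2 := sobSq_nonneg L (r / 2) (w t)
    linarith
  have hdist : sobSq L 1 (fun x => w t x - v t x) ≤ E t + tailSq L (r / 2) N (w t) := by
    refine (((hwm t ht).sub hL (memSob_of_mem_trigSpace hL (r / 2) hvt)).sobSq_mono hr1).trans ?_
    rw [sobSq_sub_of_mem_trigSpace hL (hwm t ht) hvt]
    exact add_le_add hθE le_rfl
  have hΔE : ∑ k ∈ freqs N, (1 + (k : ℝ) ^ 2) * ‖Δ k‖ ^ 2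
      ≤ K * (E t + tailSq L (r / 2) N (w t)) :=
    (hK _ _ (hw.mem t ht) (hv.mem t ht) hwR' hvR (freqs N)).trans
      (mul_le_mul_of_nonneg_left hdist hK0)
  have hterm : ∀ k ∈ freqs N, ω k * (2 * inner ℝ (θ k) (θ' k) + 2 * inner ℝ (θ' k) (θ'' k)) ≤
      2 * (ω k * (‖θ k‖ ^ 2 + ‖θ' k‖ ^ 2)) + 2 * C * (ω k * ‖θ k‖ ^ 2)
        + 2 * C * ((1 + (k : ℝ) ^ 2) * ‖Δ k‖ ^ 2) := by
    intro k _
    have h1 := two_mul_inner_le (θ k) (θ' k)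
    have h2 := two_mul_inner_le (θ' k) (θ'' k)
    have h3 : ω k * ‖θ'' k‖ ^ 2
        ≤ 2 * C * (ω k * ‖θ k‖ ^ 2) + 2 * C * ((1 + (k : ℝ) ^ 2) * ‖Δ k‖ ^ 2) := by
      have e : ω k * ‖θ'' k‖ ^ 2 = (ω k * ‖symbol L β k‖ ^ 2) * ‖θ k + Δ k‖ ^ 2 := by
        simp only [hθ'', norm_mul, norm_neg]
        ring
      rw [e]
      have h4 := mul_le_mul (hC k) (norm_add_sq_le_two (θ k) (Δ k)) (sq_nonneg _)
        (mul_nonneg hC0 (weight_pos k).le)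
      have h5 : C * ((1 + (k : ℝ) ^ 2) * ‖θ k‖ ^ 2) ≤ C * (ω k * ‖θ k‖ ^ 2) :=
        mul_le_mul_of_nonneg_left (mul_le_mul_of_nonneg_right (hω1 k) (sq_nonneg _)) hC0
      linarith
    have h6 := mul_le_mul_of_nonneg_left (add_le_add h1 h2) (hω0 k)
    have h7 : 0 ≤ ω k * ‖θ k‖ ^ 2 := mul_nonneg (hω0 k) (sq_nonneg _)
    linarith
  have hsum := Finset.sum_le_sum hterm
  rw [Finset.sum_add_distrib, Finset.sum_add_distrib, ← Finset.mul_sum, ← Finset.mul_sum,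
    ← Finset.mul_sum, ← hEt] at hsum
  have ht0 : 0 ≤ tailSq L (r / 2) N (w t) := tailSq_nonneg (hwm t ht) N
  have hE0 : 0 ≤ E t := modeEnergy_nonneg _ _ _ _ _ _ _ _
  have h8 := mul_le_mul_of_nonneg_left hθE (by positivity : 0 ≤ 2 * C)
  have h9 := mul_le_mul_of_nonneg_left hΔE (by positivity : 0 ≤ 2 * C)
  have h10 : 0 ≤ (2 + 2 * C) * tailSq L (r / 2) N (w t) := by positivity
  linarith

/-- A Grönwall inequality in which the differential inequality is only required where the function
touches the bound to be proved. -/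
theorem le_mul_exp_of_derivWithin_le {E : ℝ → ℝ} {T K δ : ℝ} (hK : 0 ≤ K) (hδ : 0 < δ)
    (hE : DifferentiableOn ℝ E (Icc 0 T)) (h0 : E 0 ≤ δ)
    (hbound : ∀ t ∈ Icc 0 T, E t = δ * Real.exp (2 * (K + 1) * t) →
      derivWithin E (Icc 0 T) t ≤ K * (E t + δ)) :
    ∀ t ∈ Icc 0 T, E t ≤ δ * Real.exp (2 * (K + 1) * t) := by
  refine image_le_of_deriv_right_lt_deriv_boundary (f' := fun t => derivWithin E (Icc 0 T) t)
    (B' := fun t => δ * (Real.exp (2 * (K + 1) * t) * (2 * (K + 1) * 1))) hE.continuousOn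
    (fun t ht => ?_) (by simpa using h0) (fun t => ?_) fun t ht heq => ?_
  · exact (hE t (Ico_subset_Icc_self ht)).hasDerivWithinAt.mono_of_mem_nhdsWithin
      (Icc_mem_nhdsGE_of_mem ht)
  · exact (((hasDerivAt_id t).const_mul (2 * (K + 1))).exp).const_mul δ
  · have h1 := hbound t (Ico_subset_Icc_self ht) heq
    have h2 : δ ≤ E t := by
      rw [heq]
      exact le_mul_of_one_le_right hδ.le (Real.one_le_exp (mul_nonneg (by linarith) ht.1))
    have h3 : K * (E t + δ) ≤ K * (2 * E t) := mul_le_mul_of_nonneg_left (by linarith) hK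
    have h4 : δ * (Real.exp (2 * (K + 1) * t) * (2 * (K + 1) * 1)) = 2 * (K + 1) * E t := by
      rw [heq]; ring
    simp only [h4]
    linarith

/-! ### Comparison of two solutions -/

/-- Two solutions with the same initial data, the second one in `S_N`, stay within a multiple of
the projection error of the first one. It suffices that the bound to be proved, or the energy
itself, does not exceed the threshold `R` for which the energy inequality is known. -/
theorem exists_modeEnergy_le {L : ℝ} (hL : 0 < L) {T : ℝ} (hT : 0 < T) {r : ℝ} (hr : 2 ≤ r)
    {β : ℝ → ℝ} {Cβ : ℝ}
    (hβ : ∀ k : ℝ, (kernelHat β k).im = 0 ∧ 0 ≤ (kernelHat β k).re ∧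
      (kernelHat β k).re ≤ Cβ * (1 + k ^ 2) ^ (-(r / 2)))
    {G : ℂ → ℂ} (hG : ContDiff ℝ 2 G) (R : ℝ) :
    ∃ M : ℝ, 1 ≤ M ∧ ∀ (N : ℕ) (w wt v vt : ℝ → ℝ → ℂ) (δ : ℝ), 0 ≤ δ →
      SolvesModes L T β G N w wt → SolvesModes L T β G N v vt →
      (∀ t ∈ Icc 0 T, v t ∈ trigSpace L N) → (∀ t ∈ Icc 0 T, MemSob L (r / 2) (w t)) →
      (∀ t ∈ Icc 0 T, sobSq L (r / 2) (w t) ≤ R) →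
      (∀ t ∈ Icc 0 T, tailSq L (r / 2) N (w t) ≤ δ) →
      (∀ k ∈ freqs N, pCoeff L (w 0) k = pCoeff L (v 0) k) →
      (∀ k ∈ freqs N, pCoeff L (wt 0) k = pCoeff L (vt 0) k) →
      (δ * M < R ∨ ∀ t ∈ Icc 0 T, modeEnergy L (r / 2) N w wt v vt t ≤ R) →
      ∀ t ∈ Icc 0 T, modeEnergy L (r / 2) N w wt v vt t ≤ δ * M := by
  obtain ⟨K, hK0, hK⟩ := exists_modeEnergy_deriv_le hL hT hr hβ hG R
  set M := Real.exp (2 * (K + 1) * T) with hM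
  have hM1 : 1 ≤ M := Real.one_le_exp (by positivity)
  have hM0 : 0 < M := by linarith
  refine ⟨M, hM1, ?_⟩
  intro N w wt v vt δ hδ hw hv hvN hwm hwR htail h0 h0' hthr
  set E := modeEnergy L (r / 2) N w wt v vt with hE
  have hE0 : E 0 = 0 := Finset.sum_eq_zero fun k hk => by
    rw [h0 k hk, h0' k hk]
    simp
  -- the comparison is strict, so it is made with every `δ' > δ` and then passed to the limit
  have key : ∀ δ' > δ, (δ' * M ≤ R ∨ ∀ t ∈ Icc 0 T, E t ≤ R) → ∀ t ∈ Icc 0 T, E t ≤ δ' * M := by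
    intro δ' hδ' hthr' t ht
    have hpos : 0 < δ' := lt_of_le_of_lt hδ hδ'
    have hexp : ∀ t ∈ Icc 0 T, δ' * Real.exp (2 * (K + 1) * t) ≤ δ' * M := fun t ht =>
      mul_le_mul_of_nonneg_left (Real.exp_le_exp.2
        (mul_le_mul_of_nonneg_left ht.2 (by positivity))) hpos.le
    refine (le_mul_exp_of_derivWithin_le (E := E) hK0 hpos
      (fun t ht => (hK N w wt v vt hw hv hvN hwm t ht).1) (by rw [hE0]; exact hpos.le)
      (fun t ht heq => ?_) t ht).trans (hexp t ht)
    have hER : E t ≤ R := by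
      rcases hthr' with h | h
      · rw [heq]; exact (hexp t ht).trans h
      · exact h t ht
    refine ((hK N w wt v vt hw hv hvN hwm t ht).2 (hwR t ht) hER).trans ?_
    exact mul_le_mul_of_nonneg_left (add_le_add le_rfl ((htail t ht).trans hδ'.le)) hK0
  intro t ht
  rcases hthr with h | h
  · have hlt : δ < R / M := (lt_div_iff₀ hM0).2 h
    have h1 : ∀ δ' ∈ Ioo δ (R / M), E t ≤ δ' * M := fun δ' hδ' =>
      key δ' hδ'.1 (Or.inl ((le_div_iff₀ hM0).1 hδ'.2.le)) t ht
    have h2 : Tendsto (fun δ' => δ' * M) (𝓝[>] δ) (𝓝 (δ * M)) :=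
      ((continuous_id.mul continuous_const).tendsto δ).mono_left nhdsWithin_le_nhds
    exact ge_of_tendsto h2 (by filter_upwards [Ioo_mem_nhdsGT hlt] with δ' hδ' using h1 δ' hδ')
  · have h2 : Tendsto (fun δ' => δ' * M) (𝓝[>] δ) (𝓝 (δ * M)) :=
      ((continuous_id.mul continuous_const).tendsto δ).mono_left nhdsWithin_le_nhds
    refine ge_of_tendsto h2 ?_
    filter_upwards [self_mem_nhdsWithin] with δ' hδ' using key δ' hδ' (Or.inr h) t ht

theorem IsC1Sob.continuousOn_modeEnergy {L T s₁ s₂ : ℝ} (hL : 0 < L) (s : ℝ) (N : ℕ)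
    {w wt v vt : ℝ → ℝ → ℂ} (hw : IsC1Sob L s₁ T w wt) (hv : IsC1Sob L s₂ T v vt) :
    ContinuousOn (modeEnergy L s N w wt v vt) (Icc 0 T) := by
  have h : ∀ {s' : ℝ} {w wt : ℝ → ℝ → ℂ}, IsC1Sob L s' T w wt → ∀ k,
      ContinuousOn (fun t => pCoeff L (wt t) k) (Icc 0 T) := by
    intro s' w wt hw k
    refine ((((lp.evalCLM ℝ (fun _ : ℤ => ℂ) 2 k).continuous.comp_continuousOn
      (hw.continuousOn_sobVec_deriv hL)).const_smul ((1 + (k : ℝ) ^ 2) ^ (s' / 2))⁻¹)).congr ?_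
    exact fun t ht => (hw.mem_deriv t ht).pCoeff_eq_eval k
  have h' : ∀ {s' : ℝ} {w wt : ℝ → ℝ → ℂ}, IsC1Sob L s' T w wt → ∀ k,
      ContinuousOn (fun t => pCoeff L (w t) k) (Icc 0 T) := fun hw k t ht =>
    (hw.hasDerivWithinAt_pCoeff hL ht k).continuousWithinAt
  refine continuousOn_finsetSum _ fun k _ => continuousOn_const.mul ?_
  exact (((h' hw k).sub (h' hv k)).norm.pow 2).add (((h hw k).sub (h hv k)).norm.pow 2)

theorem IsSemiDiscrete.pCoeff_zero {L T : ℝ} (hL : 0 < L) {N : ℕ} {β : ℝ → ℝ} {G : ℂ → ℂ}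
    {φ ψ : ℝ → ℝ} {v vt : ℝ → ℝ → ℂ} (hv : IsSemiDiscrete L T N β G φ ψ v vt) :
    (∀ k ∈ freqs N, pCoeff L (v 0) k = pCoeff L (fun x => (φ x : ℂ)) k) ∧
      ∀ k ∈ freqs N, pCoeff L (vt 0) k = pCoeff L (fun x => (ψ x : ℂ)) k := by
  constructor <;> intro k hk
  · rw [funext hv.init]
    unfold proj
    rw [pCoeff_trigPoly hL, if_pos hk]
  · rw [funext hv.init_deriv]
    unfold proj
    rw [pCoeff_trigPoly hL, if_pos hk]

/-- For fixed `N` the semi-discrete scheme has at most one solution, as far as the Fourier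
coefficients are concerned. -/
theorem IsSemiDiscrete.pCoeff_unique {L : ℝ} (hL : 0 < L) {T : ℝ} (hT : 0 < T) {r : ℝ}
    (hr : 2 ≤ r) {β : ℝ → ℝ} (hβi : Integrable β) {Cβ : ℝ}
    (hβ : ∀ k : ℝ, (kernelHat β k).im = 0 ∧ 0 ≤ (kernelHat β k).re ∧
      (kernelHat β k).re ≤ Cβ * (1 + k ^ 2) ^ (-(r / 2)))
    {G : ℂ → ℂ} (hG : ContDiff ℝ 2 G) {N : ℕ} {φ ψ : ℝ → ℝ} {v vt w wt : ℝ → ℝ → ℂ}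
    (hw : IsSemiDiscrete L T N β G φ ψ w wt) (hv : IsSemiDiscrete L T N β G φ ψ v vt) :
    ∀ t ∈ Icc 0 T, ∀ k ∈ freqs N,
      pCoeff L (w t) k = pCoeff L (v t) k ∧ pCoeff L (wt t) k = pCoeff L (vt t) k := by
  obtain ⟨hwC, hwS⟩ := hw.isC1Sob hL hT hβi (r / 2)
  obtain ⟨hvC, hvS⟩ := hv.isC1Sob hL hT hβi (r / 2)
  obtain ⟨R₁, hR₁⟩ := isCompact_Icc.bddAbove_image (hwC.continuousOn_sobSq hL)
  obtain ⟨R₂, hR₂⟩ := isCompact_Icc.bddAbove_image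
    (hwC.continuousOn_modeEnergy hL (r / 2) N hvC)
  obtain ⟨M, -, hM⟩ := exists_modeEnergy_le hL hT hr hβ hG (max R₁ R₂)
  have h0 := hw.pCoeff_zero hL
  have h0' := hv.pCoeff_zero hL
  intro t ht k hk
  have hE := hM N w wt v vt 0 le_rfl hwS hvS hv.mem hwC.mem
    (fun t ht => (hR₁ (mem_image_of_mem _ ht)).trans (le_max_left _ _))
    (fun t ht => (tailSq_eq_zero_of_mem_trigSpace hL _ (hw.mem t ht)).le)
    (fun k hk => (h0.1 k hk).trans (h0'.1 k hk).symm)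
    (fun k hk => (h0.2 k hk).trans (h0'.2 k hk).symm)
    (Or.inr fun t ht => (hR₂ (mem_image_of_mem _ ht)).trans (le_max_right _ _)) t ht
  rw [zero_mul] at hE
  have hz := (Finset.sum_eq_zero_iff_of_nonneg fun k _ =>
    mul_nonneg (weight_rpow_pos (r / 2) k).le (by positivity)).1
    (le_antisymm hE (modeEnergy_nonneg _ _ _ _ _ _ _ _)) k hk
  have hz' := (mul_eq_zero.1 hz).resolve_left (weight_rpow_pos (r / 2) k).ne'
  have h1 := sq_nonneg ‖pCoeff L (w t) k - pCoeff L (v t) k‖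
  have h2 := sq_nonneg ‖pCoeff L (wt t) k - pCoeff L (vt t) k‖
  constructor
  · exact sub_eq_zero.1 (norm_eq_zero.1 (pow_eq_zero_iff two_ne_zero |>.1 (by linarith)))
  · exact sub_eq_zero.1 (norm_eq_zero.1 (pow_eq_zero_iff two_ne_zero |>.1 (by linarith)))

/-- The energies of all semi-discrete solutions are bounded, uniformly in `N`. For large `N` the
projection error is small enough for the energy inequality with threshold `1` to close; each of the
remaining `N` admits at most one solution. -/
theorem exists_uniform_modeEnergy_bound {L : ℝ} (hL : 0 < L) {T : ℝ} (hT : 0 < T) {r : ℝ}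
    (hr : 2 ≤ r) {β : ℝ → ℝ} (hβi : Integrable β) {Cβ : ℝ}
    (hβ : ∀ k : ℝ, (kernelHat β k).im = 0 ∧ 0 ≤ (kernelHat β k).re ∧
      (kernelHat β k).re ≤ Cβ * (1 + k ^ 2) ^ (-(r / 2)))
    {G : ℂ → ℂ} (hG : ContDiff ℝ 2 G) {φ ψ : ℝ → ℝ} {w wt : ℝ → ℝ → ℂ}
    (hwC : IsC1Sob L (r / 2) T w wt) (hwS : ∀ N, SolvesModes L T β G N w wt)
    (h0 : ∀ k, pCoeff L (w 0) k = pCoeff L (fun x => (φ x : ℂ)) k)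
    (h0' : ∀ k, pCoeff L (wt 0) k = pCoeff L (fun x => (ψ x : ℂ)) k) :
    ∃ ρ : ℝ, ∀ (N : ℕ) (v vt : ℝ → ℝ → ℂ), IsSemiDiscrete L T N β G φ ψ v vt →
      ∀ t ∈ Icc 0 T, modeEnergy L (r / 2) N w wt v vt t ≤ ρ := by
  have hsmall : ∀ N, ∃ ρ : ℝ, ∀ (v vt : ℝ → ℝ → ℂ), IsSemiDiscrete L T N β G φ ψ v vt →
      ∀ t ∈ Icc 0 T, modeEnergy L (r / 2) N w wt v vt t ≤ ρ := by
    intro N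
    by_cases hex : ∃ v₀ vt₀, IsSemiDiscrete L T N β G φ ψ v₀ vt₀
    · obtain ⟨v₀, vt₀, hv₀⟩ := hex
      obtain ⟨ρ, hρ⟩ := isCompact_Icc.bddAbove_image
        (hwC.continuousOn_modeEnergy hL (r / 2) N (hv₀.isC1Sob hL hT hβi (r / 2)).1)
      refine ⟨ρ, fun v vt hv t ht => ?_⟩
      have huniq := hv.pCoeff_unique hL hT hr hβi hβ hG hv₀ t ht
      have e : modeEnergy L (r / 2) N w wt v vt t = modeEnergy L (r / 2) N w wt v₀ vt₀ t :=
        Finset.sum_congr rfl fun k hk => by rw [(huniq k hk).1, (huniq k hk).2]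
      rw [e]
      exact hρ (mem_image_of_mem _ ht)
    · exact ⟨0, fun v vt hv => absurd ⟨v, vt, hv⟩ hex⟩
  choose ρ hρ using hsmall
  obtain ⟨R, hR⟩ := isCompact_Icc.bddAbove_image (hwC.continuousOn_sobSq hL)
  obtain ⟨M, hM1, hM⟩ := exists_modeEnergy_le hL hT hr hβ hG (max R 2)
  have hM0 : 0 < M := by linarith
  obtain ⟨N₀, hN₀⟩ := eventually_atTop.1
    (hwC.eventually_tailSq_le hL (inv_pos.2 hM0))
  refine ⟨1 + ∑ N ∈ Finset.range N₀, |ρ N|, fun N v vt hv t ht => ?_⟩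
  rcases lt_or_ge N N₀ with hN | hN
  · have h1 := Finset.single_le_sum (f := fun N => |ρ N|) (fun _ _ => abs_nonneg _)
      (Finset.mem_range.2 hN)
    have h2 := hρ N v vt hv t ht
    linarith [le_abs_self (ρ N)]
  · have hv0 := hv.pCoeff_zero hL
    have hE := hM N w wt v vt M⁻¹ (inv_pos.2 hM0).le (hwS N) (hv.isC1Sob hL hT hβi (r / 2)).2
      hv.mem hwC.mem (fun t ht => (hR (mem_image_of_mem _ ht)).trans (le_max_left _ _))
      (hN₀ N hN) (fun k hk => (h0 k).trans (hv0.1 k hk).symm)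
      (fun k hk => (h0' k).trans (hv0.2 k hk).symm)
      (Or.inl (by
        rw [inv_mul_cancel₀ hM0.ne']
        exact one_lt_two.trans_le (le_max_right _ _))) t ht
    rw [inv_mul_cancel₀ hM0.ne'] at hE
    have : 0 ≤ ∑ N ∈ Finset.range N₀, |ρ N| := Finset.sum_nonneg fun _ _ => abs_nonneg _
    linarith

end NonlocalWave

/-! ### The error estimate -/

theorem mainTheorem1
    (L : ℝ) (hL : 0 < L) (T : ℝ) (hT : 0 < T)
    (r s : ℝ) (hr : 2 ≤ r) (hs : r / 2 ≤ s)
    -- the kernel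
    (β : ℝ → ℝ) (hβ : MeasureTheory.Integrable β)
    (Cβ : ℝ)
    (hβhat : ∀ k : ℝ, (NonlocalWave.kernelHat β k).im = 0 ∧
      0 ≤ (NonlocalWave.kernelHat β k).re ∧
      (NonlocalWave.kernelHat β k).re ≤ Cβ * (1 + k ^ 2) ^ (-(r / 2)))
    -- the nonlinearity, and any real-`C²` extension of it to complex arguments
    (g : ℝ → ℝ) (hg : ContDiff ℝ 2 g)
    (G : ℂ → ℂ) (hG : ContDiff ℝ 2 G) (hGg : ∀ x : ℝ, G (x : ℂ) = (g x : ℂ))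
    -- the initial data
    (φ ψ : ℝ → ℝ)
    (hφ : NonlocalWave.MemSob L s (fun x => (φ x : ℂ)))
    (hψ : NonlocalWave.MemSob L s (fun x => (ψ x : ℂ)))
    -- the exact solution and its time derivative
    (u ut : ℝ → ℝ → ℝ)
    (huC : NonlocalWave.IsC1Sob L s T (fun t x => (u t x : ℂ)) (fun t x => (ut t x : ℂ)))
    (hu : NonlocalWave.IsSolution L T β g φ ψ u ut) :
    ∃ C : ℝ, 0 < C ∧ ∀ N : ℕ, 0 < N → ∀ uN uNt : ℝ → ℝ → ℂ,
      NonlocalWave.IsSemiDiscrete L T N β G φ ψ uN uNt →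
        NonlocalWave.IsC1Sob L (r / 2) T
          (fun t x => (u t x : ℂ) - uN t x) (fun t x => (ut t x : ℂ) - uNt t x) ∧
        NonlocalWave.xNorm L (r / 2) T
            (fun t x => (u t x : ℂ) - uN t x) (fun t x => (ut t x : ℂ) - uNt t x) ≤
          C * (N : ℝ) ^ (r / 2 - s) *
            NonlocalWave.xNorm L s T (fun t x => (u t x : ℂ)) (fun t x => (ut t x : ℂ)) := by
  have hr1 : (1 : ℝ) ≤ r / 2 := by linarith
  have hC := huC.mono hL hs
  have hS := hu.solvesModes hL hβ hG.continuous hGg (huC.mono hL (hr1.trans hs))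
  have h0 : ∀ k, NonlocalWave.pCoeff L (fun x => (u 0 x : ℂ)) k
      = NonlocalWave.pCoeff L (fun x => (φ x : ℂ)) k :=
    NonlocalWave.pCoeff_congr_ae (hu.init.fun_comp ((↑) : ℝ → ℂ))
  have h0' : ∀ k, NonlocalWave.pCoeff L (fun x => (ut 0 x : ℂ)) k
      = NonlocalWave.pCoeff L (fun x => (ψ x : ℂ)) k :=
    NonlocalWave.pCoeff_congr_ae (hu.init_deriv.fun_comp ((↑) : ℝ → ℂ))
  obtain ⟨ρ, hρ⟩ := NonlocalWave.exists_uniform_modeEnergy_bound hL hT hr hβ hβhat hG hC hS h0 h0'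
  obtain ⟨R, hR⟩ := isCompact_Icc.bddAbove_image (hC.continuousOn_sobSq hL)
  obtain ⟨M, hM1, hM⟩ := NonlocalWave.exists_modeEnergy_le hL hT hr hβhat hG (max R ρ)
  set X := NonlocalWave.xNorm L s T (fun t x => (u t x : ℂ)) (fun t x => (ut t x : ℂ)) with hX
  have hX0 : 0 ≤ X := by
    refine Real.sSup_nonneg ?_
    rintro _ ⟨t, -, rfl⟩
    exact Real.sqrt_nonneg _
  refine ⟨(16 : ℝ) ^ ((s - r / 2) / 2) * Real.sqrt (M + 1), by positivity, ?_⟩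
  intro N hN v vt hv
  obtain ⟨hvC, hvS⟩ := hv.isC1Sob hL hT hβ (r / 2)
  have hd := hC.sub hL hvC
  refine ⟨hd, ?_⟩
  have hv0 := hv.pCoeff_zero hL
  -- the projection error, in terms of `Q = (N² / 16)^{r/2 - s}`
  set Q : ℝ := ((N : ℝ) ^ 2 / 16) ^ (r / 2 - s) with hQ
  have hN0 : (0 : ℝ) < N := by exact_mod_cast hN
  have hQ0 : 0 ≤ Q := Real.rpow_nonneg (by positivity) _
  have htail : ∀ t ∈ Set.Icc 0 T,
      NonlocalWave.tailSq L (r / 2) N (fun x => (u t x : ℂ))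
        + NonlocalWave.tailSq L (r / 2) N (fun x => (ut t x : ℂ)) ≤ Q * X ^ 2 := by
    intro t ht
    refine (add_le_add (NonlocalWave.tailSq_le hs hN (huC.mem t ht))
      (NonlocalWave.tailSq_le hs hN (huC.mem_deriv t ht))).trans ?_
    rw [← mul_add]
    exact mul_le_mul_of_nonneg_left (huC.le_xNorm hL ht) hQ0
  have hE := hM N _ _ v vt (Q * X ^ 2) (by positivity) (hS N) hvS hv.mem hC.mem
    (fun t ht => (hR (Set.mem_image_of_mem _ ht)).trans (le_max_left _ _))
    (fun t ht => (le_add_of_nonneg_right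
      (NonlocalWave.tailSq_nonneg (hC.mem_deriv t ht) N)).trans (htail t ht))
    (fun k hk => (h0 k).trans (hv0.1 k hk).symm) (fun k hk => (h0' k).trans (hv0.2 k hk).symm)
    (Or.inr fun t ht => (hρ N v vt hv t ht).trans (le_max_right _ _))
  have hQsqrt : Real.sqrt Q = (16 : ℝ) ^ ((s - r / 2) / 2) * (N : ℝ) ^ (r / 2 - s) := by
    rw [Real.sqrt_eq_rpow, hQ, ← Real.rpow_mul (by positivity),
      Real.div_rpow (by positivity) (by norm_num), ← Real.rpow_natCast, ← Real.rpow_mul hN0.le,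
      div_eq_mul_inv, ← Real.rpow_neg (by norm_num), mul_comm]
    congr 2 <;> push_cast <;> ring
  refine csSup_le ((Set.nonempty_Icc.2 hT.le).image _) ?_
  rintro _ ⟨t, ht, rfl⟩
  have hvt : vt t ∈ NonlocalWave.trigSpace L N :=
    (NonlocalWave.hasDerivWithinAt_pCoeff_of_trigSpace hL hT hv.mem hv.hasDeriv t ht).1
  have hsum : NonlocalWave.sobSq L (r / 2) (fun x => (u t x : ℂ) - v t x)
      + NonlocalWave.sobSq L (r / 2) (fun x => (ut t x : ℂ) - vt t x) ≤ Q * (M + 1) * X ^ 2 := by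
    rw [NonlocalWave.sobSq_sub_of_mem_trigSpace hL (hC.mem t ht) (hv.mem t ht),
      NonlocalWave.sobSq_sub_of_mem_trigSpace hL (hC.mem_deriv t ht) hvt]
    have h1 := hE t ht
    rw [NonlocalWave.modeEnergy_eq] at h1
    linarith [htail t ht]
  refine (Real.sqrt_le_sqrt hsum).trans (le_of_eq ?_)
  rw [Real.sqrt_mul (by positivity), Real.sqrt_sq hX0, Real.sqrt_mul hQ0, hQsqrt]
  ring
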